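/- Let $\Phi$ be a homogeneous Poisson point process of intensity $\lambda>0$ in $\mathbb{R}^3$. The Voronoi cell of $X\in\Phi$ is $\mathcal V_X=\{x\in\mathbb{R}^3:\ \|x-X\|\le\|x-Y\|\text{ for all }Y\in\Phi\}$, and a $2$-facet of the Voronoi tessellation is a set $\mathcal V_X\cap\mathcal V_Y$ of affine dimension $2$ with $X\ne Y$ in $\Phi$; $X$ and $Y$ are the two nuclei creating it. Let $\{p+zd:\ z\in\mathbb{R}\}$, with $p,d\in\mathbb{R}^3$ and $\|d\|=1$, be a fixed line (for instance the $x$-axis), and let $\Upsilon\subset\mathbb{R}$ be the set of all $z$ such that $p+zd$ lies on a $2$-facet. Fix the following two conventions. First, fix a translation-invariant, Borel measurable strict order $\prec$ on $\mathbb{R}^3$ for which almost every $v\in\mathbb{R}^3$ is comparable with $0$ (for instance, the order of the $x$-coordinates). Second, fix a Borel measurable choice of an orientation for each plane through the origin, given by a Borel set of normal vectors that contains exactly one of the two open rays of each line through the origin; a plane not through the origin gets the orientation of its parallel through the origin. If $Z=p+zd$, $z\in\Upsilon$, lies on the $2$-facet created by the nuclei $X_1\prec X_2$, let $\Theta(z)\in(0,2\pi)$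 be the angle from $X_1-Z$ to $X_2-Z$ in the oriented plane that contains $X_1$, $X_2$ and $Z$ (if these three points are collinear, then $\Theta(z)=\pi$). Let $\mu=\mathbb{E}\,\#(\Upsilon\cap[0,1])$ be the linear intensity of $\Upsilon$, and for Borel $A\subset\mathbb{R}$ let $$\mathbb{P}^0_\Upsilon(\Theta\in A)=\frac1\mu\,\mathbb{E}\,\#\{z\in\Upsilon\cap[0,1]:\ \Theta(z)\in A\}$$ be the Palm distribution of $\Theta$ with respect to $\Upsilon$. Then the following hold. (a) Almost surely, for every $z\in\Upsilon$ the point $p+zd$ lies on exactly one $2$-facet, created by exactly one pair of nuclei $X_1\prec X_2$, so that $\Theta(z)$ is well defined. Moreover $0<\mu<\infty$, and $\mathbb{E}\,\#\{z\in\Upsilon\cap B:\ \Theta(z)\in A\}=\mu\,|B|\,\mathbb{P}^0_\Upsilon(\Theta\in A)$ for all Borel sets $A,B\subset\mathbb{R}$, where $|B|$ is the Lebesgue measure of $B$; thus the Palm distribution does not depend on the window $[0,1]$. (b) The Palm distribution of $\Theta$ with respect to $\Upsilon$ has the density $$f_\Theta(t)=\tfrac34\left|\cos\tfrac t2\right|\sin^2\tfrac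 t2,\qquad t\in(0,2\pi),$$ that is, $\mathbb{P}^0_\Upsilon(\Theta\in A)=\int_{A\cap(0,2\pi)}f_\Theta(t)\,dt$ for every Borel set $A\subset\mathbb{R}$. (c) For all $t\in(0,\pi)$, $$\mathbb{P}^0_\Upsilon(\Theta\in(t,\pi))=\tfrac12\left(1-\sin^3\tfrac t2\right).$$ -/

import Mathlib

open MeasureTheory ProbabilityTheory Set
open scoped NNReal ENNReal

namespace PoissonVoronoi

noncomputable section

/-- Euclidean three-space, with the Euclidean norm and Lebesgue measure `volume`. -/
abbrev E3 : Type := EuclideanSpace ℝ (Fin 3)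

/-- `Φ` is a homogeneous (equivalently, stationary) Poisson point process of intensity `lam` on
`ℝ³`: a random locally finite set of points whose numbers of points in Borel sets are random
variables, are Poisson distributed with mean `lam * volume B` for each Borel set `B` of finite
volume, and are independent for disjoint Borel sets. -/
structure IsPoissonProcess {Ω : Type*} [MeasurableSpace Ω] (P : Measure Ω)
    (Φ : Ω → Set E3) (lam : ℝ≥0) : Prop where
  locallyFinite : ∀ᵐ ω ∂P, ∀ R : ℝ, (Φ ω ∩ Metric.closedBall 0 R).Finite
  measurable_count : ∀ B : Set E3, MeasurableSet B → Measurable fun ω => (Φ ω ∩ B).encard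
  poisson_count : ∀ B : Set E3, MeasurableSet B → volume B ≠ ∞ → ∀ k : ℕ,
    P {ω | (Φ ω ∩ B).encard = k} = poissonMeasure (lam * (volume B).toNNReal) {k}
  indep_count : ∀ (n : ℕ) (B : Fin n → Set E3), (∀ i, MeasurableSet (B i)) →
    Pairwise (fun i j => Disjoint (B i) (B j)) →
    iIndepFun (fun i ω => (Φ ω ∩ B i).encard) P

/-- The closed Voronoi cell of the nucleus `X` with respect to the point configuration `φ`. -/
def voronoiCell (φ : Set E3) (X : E3) : Set E3 :=
  {x | ∀ Y ∈ φ, dist x X ≤ dist x Y}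

/-- The common boundary of the cells of `X` and `Y`. -/
def facet (φ : Set E3) (X Y : E3) : Set E3 :=
  voronoiCell φ X ∩ voronoiCell φ Y

/-- `X` and `Y` are two distinct nuclei whose cells share a two-dimensional facet, and the
point `x` lies on this facet. -/
def OnTwoFacet (φ : Set E3) (X Y x : E3) : Prop :=
  X ∈ φ ∧ Y ∈ φ ∧ X ≠ Y ∧ Module.finrank ℝ (vectorSpan ℝ (facet φ X Y)) = 2 ∧ x ∈ facet φ X Y

/-- The point with abscissa `z` on the line through `p` with unit direction `d`. -/
def linePoint (p d : E3) (z : ℝ) : E3 := p + z • d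

/-- The point process of crossings of the line with the two-dimensional facets of the Voronoi
tessellation of `φ`; a crossing is represented by its abscissa on the line. -/
def crossings (φ : Set E3) (p d : E3) : Set ℝ :=
  {z | ∃ X Y : E3, OnTwoFacet φ X Y (linePoint p d z)}

/-- A convention for ordering pairs of points of `ℝ³`: a strict order which is invariant under
translations, Borel measurable, and for which almost all pairs of points are comparable.
The order of the first coordinates, or the lexicographic order, are examples. -/
structure IsPairOrder (r : E3 → E3 → Prop) : Prop where
  irrefl : ∀ x, ¬ r x x
  trans : ∀ x y w, r x y → r y w → r x w
  translate : ∀ x y v, r (x + v) (y + v) ↔ r x y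
  measurable : MeasurableSet {v | r 0 v}
  ae_total : ∀ᵐ v ∂(volume : Measure E3), r 0 v ∨ r v 0

/-- A convention for orienting planes of `ℝ³`: a Borel set `H` of normal vectors that contains,
for each line through the origin, exactly one of the two open rays of this line. A plane is
looked at from the side to which its normal vectors in `H` point. -/
structure IsPlaneOrientation (H : Set E3) : Prop where
  measurable : MeasurableSet H
  one_side : ∀ n : E3, n ≠ 0 → (n ∈ H ↔ -n ∉ H)
  smul_mem : ∀ (c : ℝ) (n : E3), 0 < c → n ∈ H → c • n ∈ H

/-- The cross product of `ℝ³`. -/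
def cross (u v : E3) : E3 := WithLp.toLp 2 (crossProduct (WithLp.ofLp u) (WithLp.ofLp v))

open Classical in
/-- The angle in `[0, 2π)` through which one turns counterclockwise from `X` to `Y`, seen from `x`,
in the plane through `X`, `Y` and `x`, oriented by the convention `H`. -/
def orientedAngle (H : Set E3) (X x Y : E3) : ℝ :=
  if InnerProductGeometry.angle (X - x) (Y - x) = 0 then 0
  else if cross (X - x) (Y - x) ∈ H then InnerProductGeometry.angle (X - x) (Y - x)
  else 2 * Real.pi - InnerProductGeometry.angle (X - x) (Y - x)

open Classical in
/-- The mark `Θ(z)` of a crossing `z`: the oriented angle under which the crossing sees the two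
nuclei creating the facet it lies on, from the smaller to the larger nucleus. (Almost surely every
crossing lies on exactly one two-dimensional facet; this is part of the theorem.) -/
def crossingAngle (r : E3 → E3 → Prop) (H : Set E3) (φ : Set E3) (p d : E3) (z : ℝ) : ℝ :=
  if h : ∃ q : E3 × E3, r q.1 q.2 ∧ OnTwoFacet φ q.1 q.2 (linePoint p d z) then
    orientedAngle H h.choose.1 (linePoint p d z) h.choose.2
  else 0

/-- The mean number of crossings in `B` with mark in `A`, that is
`𝔼 ∑_{z ∈ Υ} 1_B(z) 1_A(Θ(z))`. -/
def meanCrossings {Ω : Type*} [MeasurableSpace Ω] (P : Measure Ω) (Φ : Ω → Set E3)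
    (r : E3 → E3 → Prop) (H : Set E3) (p d : E3) (B A : Set ℝ) : ℝ≥0∞ :=
  ∫⁻ ω, (({z ∈ crossings (Φ ω) p d |
    z ∈ B ∧ crossingAngle r H (Φ ω) p d z ∈ A}.encard : ℕ∞) : ℝ≥0∞) ∂P

/-- The linear intensity `μ = 𝔼 Υ([0, 1])` of the point process of crossings. -/
def crossingIntensity {Ω : Type*} [MeasurableSpace Ω] (P : Measure Ω) (Φ : Ω → Set E3)
    (p d : E3) : ℝ≥0∞ :=
  ∫⁻ ω, (((crossings (Φ ω) p d ∩ Icc 0 1).encard : ℕ∞) : ℝ≥0∞) ∂P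

/-- The Palm probability `ℙ⁰_Υ(Θ(0) ∈ A)`: the intensity of the crossings with mark in `A` divided
by the intensity of all crossings. -/
def palmProb {Ω : Type*} [MeasurableSpace Ω] (P : Measure Ω) (Φ : Ω → Set E3)
    (r : E3 → E3 → Prop) (H : Set E3) (p d : E3) (A : Set ℝ) : ℝ≥0∞ :=
  meanCrossings P Φ r H p d (Icc 0 1) A / crossingIntensity P Φ p d

end

end PoissonVoronoi

/-! A point of the line lies on the common boundary of two cells when their nuclei are equidistant
from it and no nucleus is closer. In general position (no bisector plane parallel to the line, no
third nucleus on the sphere about the point where the bisector meets the line) this boundary is a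
genuine 2-facet near that point. Hence the crossings correspond one to one to ordered pairs `X ≺ Y`
whose ball about that point, with `X` and `Y` on its boundary, has no nucleus inside
(`IsGeneric.encard_crossings`). General position holds almost surely
(`IsPoissonProcess.ae_isGeneric`).

The Mecke formula for pairs (`IsPoissonProcess.lintegral_emptyBallPairs`) turns the mean number of
such pairs into `λ²` times the integral of the void probability `exp (-λ |ball|)`.
`IsPoissonProcess` speaks only of counts in Borel sets, so the formula is derived by discretisation:
pairs are sorted into disjoint cells, the two cells are cut out of the ball so that independence
applies, and the cells are refined.

For the integral, let `v = Y - X` and let `n` be the midpoint relative to the crossing. For fixed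
`v` the midpoint has as coordinates the abscissa of the crossing and the vector `n ⊥ v`, with
Jacobian `|⟪v, d⟫| / ‖v‖`, so the window `B` enters only through `|B|` (`lintegral_pairWeight`).
Adding the contributions of `n` and `-n` replaces the orientation convention by counting both `t`
and `2π - t`; adding those of `v` and `-v` removes the order. Up to constants, the weight `ρ² s dρ
ds` remains, with `ρ = ‖v‖` and `s = ‖n‖`. Put `ρ / 2 = R sin φ`, `s = R cos φ`: the void
probability depends on `R` only, the angle is `2φ`, and the weight is proportional to `R⁴ sin² φ cos
φ`. So radius and angle separate (`lintegral_sliceIntegral`), and all factors except the angular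
density form one constant, equal to `μ`. The tail formula holds because `sin³ (t/2) / 2` is an
antiderivative of the density on `(0, π)`. -/

namespace PoissonVoronoi

noncomputable section

/-! ### Moments of counts of a Poisson process -/

section Poisson

lemma tsum_mul_poissonMeasure_singleton (m : ℝ≥0) :
    ∑' k : ℕ, (k : ℝ≥0∞) * poissonMeasure m {k} = m := by
  rw [tsum_eq_zero_add' ENNReal.summable]
  have h : ∀ k : ℕ, ((k + 1 : ℕ) : ℝ≥0∞) * poissonMeasure m {k + 1}
      = m * poissonMeasure m {k} := by
    intro k
    rw [poissonMeasure_singleton, poissonMeasure_singleton, ← ENNReal.ofReal_natCast,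
      ← ENNReal.ofReal_mul (by positivity), ← ENNReal.ofReal_coe_nnreal,
      ← ENNReal.ofReal_mul (by positivity)]
    congr 1
    rw [Nat.factorial_succ]
    push_cast
    field_simp
    ring
  simp only [h, ENNReal.tsum_mul_left]
  have h1 : ∑' k : ℕ, poissonMeasure m {k} = 1 := by
    have := lintegral_countable' (μ := poissonMeasure m) (fun _ => (1 : ℝ≥0∞))
    simpa using this.symm
  simp [h1]

variable {Ω : Type*} [MeasurableSpace Ω] {P : Measure Ω} {Φ : Ω → Set E3} {lam : ℝ≥0}

lemma IsPoissonProcess.lintegral_encard (hΦ : IsPoissonProcess P Φ lam) {B : Set E3}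
    (hB : MeasurableSet B) (hfin : ∀ ω, (Φ ω ∩ B).Finite) (hvol : volume B ≠ ∞) :
    ∫⁻ ω, (((Φ ω ∩ B).encard : ℕ∞) : ℝ≥0∞) ∂P = lam * volume B := by
  have hm := hΦ.measurable_count B hB
  have h1 : ∀ ω, (((Φ ω ∩ B).encard : ℕ∞) : ℝ≥0∞) = ((Φ ω ∩ B).ncard : ℝ≥0∞) := fun ω => by
    rw [← (hfin ω).cast_ncard_eq]; simp
  have hm' : Measurable fun ω => (Φ ω ∩ B).ncard :=
    (Measurable.of_discrete (f := ENat.toNat)).comp hm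
  simp only [h1]
  have := lintegral_map (μ := P) (f := fun n : ℕ => (n : ℝ≥0∞)) .of_discrete hm'
  rw [← this, lintegral_countable']
  have h2 : ∀ k : ℕ, (P.map fun ω => (Φ ω ∩ B).ncard) {k}
      = poissonMeasure (lam * (volume B).toNNReal) {k} := by
    intro k
    rw [Measure.map_apply hm' (measurableSet_singleton k), ← hΦ.poisson_count B hB hvol k]
    congr 1
    ext ω
    simp only [mem_preimage, mem_singleton_iff, mem_ofPred_eq]
    rw [← (hfin ω).cast_ncard_eq]
    norm_cast
  simp only [h2, tsum_mul_poissonMeasure_singleton]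
  rw [ENNReal.coe_mul, ENNReal.coe_toNNReal hvol]

/-- The probability that a Poisson process of intensity `lam` has no point in `V`. -/
def voidProb (lam : ℝ≥0) (V : Set E3) : ℝ≥0∞ :=
  ENNReal.ofReal (Real.exp (-(lam * (volume V).toReal)))

lemma voidProb_le_one (lam : ℝ≥0) (V : Set E3) : voidProb lam V ≤ 1 := by
  rw [voidProb, ENNReal.ofReal_le_one, Real.exp_le_one_iff, neg_nonpos]
  positivity

lemma voidProb_ne_top (lam : ℝ≥0) (V : Set E3) : voidProb lam V ≠ ∞ := ENNReal.ofReal_ne_top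

open Classical in
lemma IsPoissonProcess.lintegral_void (hΦ : IsPoissonProcess P Φ lam) {V : Set E3}
    (hV : MeasurableSet V) (hvol : volume V ≠ ∞) :
    ∫⁻ ω, (if (Φ ω ∩ V).encard = 0 then 1 else 0) ∂P = voidProb lam V := by
  have hm := hΦ.measurable_count V hV
  have h := hΦ.poisson_count V hV hvol 0
  have : ∀ ω, (if (Φ ω ∩ V).encard = 0 then (1 : ℝ≥0∞) else 0)
      = indicator {ω | (Φ ω ∩ V).encard = 0} 1 ω := fun ω => by simp [indicator]
  simp only [this]
  rw [lintegral_indicator_one (s := {ω | (Φ ω ∩ V).encard = 0}) (hm (measurableSet_singleton 0))]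
  simp only [Nat.cast_zero] at h
  rw [h, poissonMeasure_singleton, voidProb]
  simp [ENNReal.coe_toNNReal_eq_toReal]

lemma IsPoissonProcess.lintegral_mul_mul (hΦ : IsPoissonProcess P Φ lam) {A B V : Set E3}
    (hA : MeasurableSet A) (hB : MeasurableSet B) (hV : MeasurableSet V)
    (hAB : Disjoint A B) (hAV : Disjoint A V) (hBV : Disjoint B V) (f g h : ℕ∞ → ℝ≥0∞) :
    ∫⁻ ω, f (Φ ω ∩ A).encard * g (Φ ω ∩ B).encard * h (Φ ω ∩ V).encard ∂P =
      (∫⁻ ω, f (Φ ω ∩ A).encard ∂P) * (∫⁻ ω, g (Φ ω ∩ B).encard ∂P) *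
        ∫⁻ ω, h (Φ ω ∩ V).encard ∂P := by
  have hS : ∀ i : Fin 3, MeasurableSet (![A, B, V] i) := by
    intro i; fin_cases i <;> assumption
  have hi := hΦ.indep_count 3 ![A, B, V] hS (by
    intro i j hij
    fin_cases i <;> fin_cases j <;> simp_all [disjoint_comm])
  have hi2 := hi.comp ![f, g, h] (fun i => .of_discrete)
  have := lintegral_prod_eq_prod_lintegral_of_indepFun Finset.univ _ hi2
    (fun i => (Measurable.of_discrete).comp (hΦ.measurable_count _ (hS i)))
  simpa [Fin.prod_univ_three] using this

/-- The counting measure of the points of a configuration in a window. -/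
def pointMeasure (φ : Set E3) (Q : Set E3) : Measure E3 := Measure.count.restrict (φ ∩ Q)

lemma pointMeasure_apply {φ Q : Set E3} (hfin : (φ ∩ Q).Finite) {A : Set E3}
    (hA : MeasurableSet A) : pointMeasure φ Q A = (((φ ∩ (Q ∩ A)).encard : ℕ∞) : ℝ≥0∞) := by
  rw [pointMeasure, Measure.restrict_apply hA,
    Measure.count_apply (hA.inter hfin.measurableSet), inter_comm, inter_assoc]

lemma isFiniteMeasure_pointMeasure {φ Q : Set E3} (hfin : (φ ∩ Q).Finite) :
    IsFiniteMeasure (pointMeasure φ Q) := by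
  constructor
  rw [pointMeasure_apply hfin .univ, inter_univ, ← hfin.cast_ncard_eq]
  simp

lemma lintegral_pointMeasure {φ Q : Set E3} (hfin : (φ ∩ Q).Finite) (f : E3 → ℝ≥0∞) :
    ∫⁻ x, f x ∂(pointMeasure φ Q) = ∑ x ∈ hfin.toFinset, f x := by
  have h : (φ ∩ Q) = (hfin.toFinset : Set E3) := hfin.coe_toFinset.symm
  generalize hfin.toFinset = s at h
  rw [pointMeasure, h, lintegral_finset]
  simp

/-- The counting measure of the pairs of points, the first one in `Q₁`, the second one in `Q₂`. -/
lemma pointMeasure_prod_apply {φ Q₁ Q₂ : Set E3} (h₁ : (φ ∩ Q₁).Finite) (h₂ : (φ ∩ Q₂).Finite)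
    {D : Set (E3 × E3)} (hD : MeasurableSet D) :
    (pointMeasure φ Q₁).prod (pointMeasure φ Q₂) D =
      ((((φ ∩ Q₁) ×ˢ (φ ∩ Q₂) ∩ D).encard : ℕ∞) : ℝ≥0∞) := by
  have := isFiniteMeasure_pointMeasure h₁
  have := isFiniteMeasure_pointMeasure h₂
  classical
  have e : (φ ∩ Q₁) ×ˢ (φ ∩ Q₂) ∩ D
      = ((h₁.toFinset ×ˢ h₂.toFinset).filter (· ∈ D) : Finset (E3 × E3)) := by
    ext x; simp
  rw [e, Set.encard_coe_eq_coe_finsetCard, ← lintegral_indicator_one hD,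
    lintegral_prod _ (measurable_one.indicator hD).aemeasurable, lintegral_pointMeasure h₁]
  simp only [lintegral_pointMeasure h₂]
  rw [← Finset.sum_product', Finset.card_filter]
  simp [indicator]

/-- The hypotheses give measurability of counts only, that is, of the values on rectangles.
Rectangles form a π-system, which yields all Borel sets of pairs. -/
lemma measurable_pointMeasure_prod (hΦ : IsPoissonProcess P Φ lam) {Q₁ Q₂ : Set E3}
    (hQ₁ : MeasurableSet Q₁) (hQ₂ : MeasurableSet Q₂)
    (h₁ : ∀ ω, (Φ ω ∩ Q₁).Finite) (h₂ : ∀ ω, (Φ ω ∩ Q₂).Finite) :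
    Measurable fun ω => (pointMeasure (Φ ω) Q₁).prod (pointMeasure (Φ ω) Q₂) := by
  have := fun ω => isFiniteMeasure_pointMeasure (h₁ ω)
  have := fun ω => isFiniteMeasure_pointMeasure (h₂ ω)
  have key : ∀ A B : Set E3, MeasurableSet A → MeasurableSet B →
      Measurable fun ω => (pointMeasure (Φ ω) Q₁).prod (pointMeasure (Φ ω) Q₂) (A ×ˢ B) := by
    intro A B hA hB
    simp only [Measure.prod_prod, pointMeasure_apply (h₁ _) hA, pointMeasure_apply (h₂ _) hB]
    exact ((Measurable.of_discrete (f := ENat.toENNReal)).comp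
      (hΦ.measurable_count _ (hQ₁.inter hA))).mul ((Measurable.of_discrete (f := ENat.toENNReal)).comp
      (hΦ.measurable_count _ (hQ₂.inter hB)))
  refine Measurable.measure_of_isPiSystem generateFrom_prod.symm isPiSystem_prod ?_ ?_
  · rintro _ ⟨A, hA, B, hB, rfl⟩
    exact key A B hA hB
  · simpa using key univ univ .univ .univ

/-- For a rectangle `D` the integrand is a product of functions of the counts in three disjoint
sets, so independence factors it. Both sides are measures in `D`, and agreement on rectangles
suffices. The weight `h` is kept general: it will be the constant `1`, the indicator that `V` is
empty, or the count itself, which brings in a third point. -/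
lemma IsPoissonProcess.lintegral_pair (hΦ : IsPoissonProcess P Φ lam) {Q₁ Q₂ V : Set E3}
    (hQ₁ : MeasurableSet Q₁) (hQ₂ : MeasurableSet Q₂) (hV : MeasurableSet V)
    (h₁ : ∀ ω, (Φ ω ∩ Q₁).Finite) (h₂ : ∀ ω, (Φ ω ∩ Q₂).Finite)
    (hv₁ : volume Q₁ ≠ ∞) (hv₂ : volume Q₂ ≠ ∞)
    (h12 : Disjoint Q₁ Q₂) (h1V : Disjoint Q₁ V) (h2V : Disjoint Q₂ V) (h : ℕ∞ → ℝ≥0∞)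
    (hh : ∫⁻ ω, h (Φ ω ∩ V).encard ∂P ≠ ∞) {D : Set (E3 × E3)} (hD : MeasurableSet D) :
    ∫⁻ ω, h (Φ ω ∩ V).encard *
        ((((Φ ω ∩ Q₁) ×ˢ (Φ ω ∩ Q₂) ∩ D).encard : ℕ∞) : ℝ≥0∞) ∂P =
      (∫⁻ ω, h (Φ ω ∩ V).encard ∂P) * (lam ^ 2 * volume (D ∩ Q₁ ×ˢ Q₂)) := by
  have := fun ω => isFiniteMeasure_pointMeasure (h₁ ω)
  have := fun ω => isFiniteMeasure_pointMeasure (h₂ ω)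
  set c := ∫⁻ ω, h (Φ ω ∩ V).encard ∂P
  have hmV : Measurable fun ω => h (Φ ω ∩ V).encard :=
    (Measurable.of_discrete (f := h)).comp (hΦ.measurable_count V hV)
  have hmK := measurable_pointMeasure_prod hΦ hQ₁ hQ₂ h₁ h₂
  -- The left-hand side as a measure in `D`: the mean of the random pair-counting measure under `P`
  -- with density `h`.
  set m : Measure (E3 × E3) := Measure.bind (P.withDensity fun ω => h (Φ ω ∩ V).encard)
    (fun ω => (pointMeasure (Φ ω) Q₁).prod (pointMeasure (Φ ω) Q₂)) with hm
  have hmapp : ∀ S, MeasurableSet S → m S = ∫⁻ ω, h (Φ ω ∩ V).encard *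
        ((((Φ ω ∩ Q₁) ×ˢ (Φ ω ∩ Q₂) ∩ S).encard : ℕ∞) : ℝ≥0∞) ∂P := by
    intro S hS
    rw [hm, Measure.bind_apply hS hmK.aemeasurable,
      lintegral_withDensity_eq_lintegral_mul _ hmV (Measure.measurable_measure.1 hmK S hS)]
    simp only [Pi.mul_apply, pointMeasure_prod_apply (h₁ _) (h₂ _) hS]
  have : SigmaFinite ((c * lam ^ 2) • volume.restrict Q₁) := by
    have : IsFiniteMeasure ((c * lam ^ 2) • volume.restrict Q₁) := by
      constructor
      simp only [Measure.smul_apply, Measure.restrict_apply_univ, smul_eq_mul]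
      finiteness
    infer_instance
  have key : ((c * lam ^ 2) • volume.restrict Q₁).prod (volume.restrict Q₂) = m := by
    have : IsFiniteMeasure (volume.restrict Q₂) := ⟨by simpa using hv₂.lt_top⟩
    refine Measure.prod_eq fun A B hA hB => ?_
    rw [hmapp _ (hA.prod hB)]
    have e : ∀ ω, ((((Φ ω ∩ Q₁) ×ˢ (Φ ω ∩ Q₂) ∩ A ×ˢ B).encard : ℕ∞) : ℝ≥0∞)
        = (((Φ ω ∩ (Q₁ ∩ A)).encard : ℕ∞) : ℝ≥0∞) * (((Φ ω ∩ (Q₂ ∩ B)).encard : ℕ∞) : ℝ≥0∞) := by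
      intro ω
      rw [prod_inter_prod, encard_prod, inter_assoc, inter_assoc]
      simp
    simp only [e]
    have := hΦ.lintegral_mul_mul (hQ₁.inter hA) (hQ₂.inter hB) hV
      (h12.mono inter_subset_left inter_subset_left) (h1V.mono_left inter_subset_left)
      (h2V.mono_left inter_subset_left) (fun n => (n : ℝ≥0∞)) (fun n => (n : ℝ≥0∞)) h
    rw [show (fun ω => h (Φ ω ∩ V).encard * ((((Φ ω ∩ (Q₁ ∩ A)).encard : ℕ∞) : ℝ≥0∞) *
      (((Φ ω ∩ (Q₂ ∩ B)).encard : ℕ∞) : ℝ≥0∞))) = fun ω =>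
      (((Φ ω ∩ (Q₁ ∩ A)).encard : ℕ∞) : ℝ≥0∞) * (((Φ ω ∩ (Q₂ ∩ B)).encard : ℕ∞) : ℝ≥0∞) *
        h (Φ ω ∩ V).encard from funext fun ω => by ring, this,
      hΦ.lintegral_encard (hQ₁.inter hA)
        (fun ω => (h₁ ω).subset (inter_subset_inter_right _ inter_subset_left))
        (measure_ne_top_of_subset inter_subset_left hv₁),
      hΦ.lintegral_encard (hQ₂.inter hB)
        (fun ω => (h₂ ω).subset (inter_subset_inter_right _ inter_subset_left))
        (measure_ne_top_of_subset inter_subset_left hv₂)]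
    simp only [Measure.smul_apply, smul_eq_mul, Measure.restrict_apply hA,
      Measure.restrict_apply hB, inter_comm Q₁, inter_comm Q₂]
    ring
  rw [← hmapp D hD, ← key, Measure.prod_smul_left, Measure.prod_restrict,
    Measure.smul_apply, Measure.restrict_apply hD, smul_eq_mul, Measure.volume_eq_prod]
  ring

end Poisson

/-! ### Null sets of pairs and triples of points -/

section Factorial

variable {Ω : Type*} [MeasurableSpace Ω] {P : Measure Ω} {Φ : Ω → Set E3} {lam : ℝ≥0}

/-- The cell of value `a` of the simple function `q`, cut off at distance `K`. -/
def cell (q : SimpleFunc E3 E3) (K : ℕ) (a : E3) : Set E3 := q ⁻¹' {a} ∩ Metric.closedBall 0 K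

lemma measurableSet_cell (q : SimpleFunc E3 E3) (K : ℕ) (a : E3) : MeasurableSet (cell q K a) :=
  (q.measurableSet_fiber a).inter Metric.isClosed_closedBall.measurableSet

lemma volume_cell_ne_top (q : SimpleFunc E3 E3) (K : ℕ) (a : E3) : volume (cell q K a) ≠ ∞ :=
  measure_ne_top_of_subset inter_subset_right measure_closedBall_lt_top.ne

lemma finite_inter_cell {φ : Set E3} (hφ : ∀ R : ℝ, (φ ∩ Metric.closedBall 0 R).Finite)
    (q : SimpleFunc E3 E3) (K : ℕ) (a : E3) : (φ ∩ cell q K a).Finite :=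
  (hφ K).subset (inter_subset_inter_right _ inter_subset_right)

lemma disjoint_cell (q : SimpleFunc E3 E3) (K : ℕ) {a b : E3} (hab : a ≠ b) :
    Disjoint (cell q K a) (cell q K b) := by
  refine Disjoint.mono inter_subset_left inter_subset_left ?_
  exact Disjoint.preimage _ (by simpa using hab)

/-- Simple functions converging to the identity. -/
def simpleApprox (N : ℕ) : SimpleFunc E3 E3 :=
  SimpleFunc.nearestPt (TopologicalSpace.denseSeq E3) N

lemma tendsto_simpleApprox (x : E3) :
    Filter.Tendsto (fun N => simpleApprox N x) Filter.atTop (nhds x) :=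
  SimpleFunc.tendsto_nearestPt (by
    rw [(TopologicalSpace.denseRange_denseSeq E3).closure_range]; trivial)

/-- Distinct points end up in distinct, hence disjoint, cells; this is how independence over
disjoint sets reaches pairs of points of one process. -/
lemma eventually_simpleApprox_ne {x y : E3} (hxy : x ≠ y) :
    ∀ᶠ N in Filter.atTop, simpleApprox N x ≠ simpleApprox N y :=
  ((tendsto_simpleApprox x).prodMk_nhds (tendsto_simpleApprox y)).eventually
    ((isOpen_ne_fun continuous_fst continuous_snd).mem_nhds hxy)

/-- In two disjoint cells the mean number of pairs in a null set is zero, and countably many pairs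
of cells catch all pairs of distinct points. `D` need not be Borel, hence the passage to
`toMeasurable`. -/
lemma IsPoissonProcess.ae_forall_pair (hΦ : IsPoissonProcess P Φ lam) [IsProbabilityMeasure P]
    (hlf : ∀ ω, ∀ R : ℝ, (Φ ω ∩ Metric.closedBall 0 R).Finite) {D : Set (E3 × E3)}
    (hD : volume D = 0) :
    ∀ᵐ ω ∂P, ∀ x ∈ Φ ω, ∀ y ∈ Φ ω, x ≠ y → (x, y) ∉ D := by
  have key : ∀ N K : ℕ, ∀ a ∈ ((simpleApprox N).range : Set E3),
      ∀ b ∈ ((simpleApprox N).range : Set E3), ∀ᵐ ω ∂P, a ≠ b →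
      (Φ ω ∩ cell (simpleApprox N) K a) ×ˢ (Φ ω ∩ cell (simpleApprox N) K b) ∩
        toMeasurable volume D = ∅ := by
    intro N K a _ b _
    by_cases hab : a = b
    · simp [hab]
    have hfa := fun ω => finite_inter_cell (hlf ω) (simpleApprox N) K a
    have hfb := fun ω => finite_inter_cell (hlf ω) (simpleApprox N) K b
    have hma := measurableSet_cell (simpleApprox N) K a
    have hmb := measurableSet_cell (simpleApprox N) K b
    have h := hΦ.lintegral_pair hma hmb MeasurableSet.empty hfa hfb
      (volume_cell_ne_top _ _ _) (volume_cell_ne_top _ _ _) (disjoint_cell _ _ hab)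
      (disjoint_empty _) (disjoint_empty _) (fun _ => 1) (by simp)
      (measurableSet_toMeasurable volume D)
    rw [measure_mono_null inter_subset_left ((measure_toMeasurable D).trans hD)] at h
    simp only [one_mul, mul_zero, ← pointMeasure_prod_apply (hfa _) (hfb _)
      (measurableSet_toMeasurable volume D)] at h
    rw [lintegral_eq_zero_iff (Measure.measurable_measure.1
      (measurable_pointMeasure_prod hΦ hma hmb hfa hfb) _ (measurableSet_toMeasurable volume D))] at h
    filter_upwards [h] with ω hω _
    rw [pointMeasure_prod_apply (hfa _) (hfb _) (measurableSet_toMeasurable volume D)] at hω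
    simpa using hω
  have : ∀ᵐ ω ∂P, ∀ N K : ℕ, ∀ a ∈ ((simpleApprox N).range : Set E3),
      ∀ b ∈ ((simpleApprox N).range : Set E3), a ≠ b →
      (Φ ω ∩ cell (simpleApprox N) K a) ×ˢ (Φ ω ∩ cell (simpleApprox N) K b) ∩
        toMeasurable volume D = ∅ := by
    refine ae_all_iff.2 fun N => ae_all_iff.2 fun K => ?_
    refine (ae_ball_iff (Finset.countable_toSet _)).2 fun a ha => ?_
    exact (ae_ball_iff (Finset.countable_toSet _)).2 fun b hb => key N K a ha b hb
  filter_upwards [this] with ω hω x hx y hy hxy hxD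
  obtain ⟨N, hN⟩ := (eventually_simpleApprox_ne hxy).exists
  obtain ⟨K, hK⟩ := exists_nat_ge (max ‖x‖ ‖y‖)
  have h := hω N K _ (SimpleFunc.mem_range_self _ x) _ (SimpleFunc.mem_range_self _ y) hN
  refine (h ▸ notMem_empty (x, y)) ⟨⟨⟨hx, rfl, ?_⟩, hy, rfl, ?_⟩, subset_toMeasurable _ _ hxD⟩
  · simpa using (le_max_left _ _).trans hK
  · simpa using (le_max_right _ _).trans hK

/-- The third factorial moment measure is `λ³` times Lebesgue measure. It reduces to
`IsPoissonProcess.lintegral_pair`, with the count of the third points as the weight `h`. -/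
lemma IsPoissonProcess.ae_triple_cell (hΦ : IsPoissonProcess P Φ lam) [IsProbabilityMeasure P]
    {Q₁ Q₂ Q₃ : Set E3} (hQ₁ : MeasurableSet Q₁) (hQ₂ : MeasurableSet Q₂) (hQ₃ : MeasurableSet Q₃)
    (h₁ : ∀ ω, (Φ ω ∩ Q₁).Finite) (h₂ : ∀ ω, (Φ ω ∩ Q₂).Finite) (h₃ : ∀ ω, (Φ ω ∩ Q₃).Finite)
    (hv₁ : volume Q₁ ≠ ∞) (hv₂ : volume Q₂ ≠ ∞) (hv₃ : volume Q₃ ≠ ∞)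
    (h12 : Disjoint Q₁ Q₂) (h13 : Disjoint Q₁ Q₃) (h23 : Disjoint Q₂ Q₃)
    {D : Set ((E3 × E3) × E3)} (hDm : MeasurableSet D) (hD : volume D = 0) :
    ∀ᵐ ω ∂P, ∀ x ∈ Φ ω ∩ Q₁, ∀ y ∈ Φ ω ∩ Q₂, ∀ w ∈ Φ ω ∩ Q₃, ((x, y), w) ∉ D := by
  have := fun ω => isFiniteMeasure_pointMeasure (h₁ ω)
  have := fun ω => isFiniteMeasure_pointMeasure (h₂ ω)
  have := fun ω => isFiniteMeasure_pointMeasure (h₃ ω)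
  set κ : Ω → Measure ((E3 × E3) × E3) := fun ω =>
    ((pointMeasure (Φ ω) Q₁).prod (pointMeasure (Φ ω) Q₂)).prod (pointMeasure (Φ ω) Q₃) with hκ
  have hmK := measurable_pointMeasure_prod hΦ hQ₁ hQ₂ h₁ h₂
  have hκm : Measurable κ := by
    have key : ∀ (A : Set (E3 × E3)) (B : Set E3), MeasurableSet A → MeasurableSet B →
        Measurable fun ω => κ ω (A ×ˢ B) := by
      intro A B hA hB
      simp only [hκ, Measure.prod_prod, pointMeasure_apply (h₃ _) hB]
      exact (Measure.measurable_measure.1 hmK A hA).mul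
        ((Measurable.of_discrete (f := ENat.toENNReal)).comp
          (hΦ.measurable_count _ (hQ₃.inter hB)))
    refine Measurable.measure_of_isPiSystem generateFrom_prod.symm isPiSystem_prod ?_ ?_
    · rintro _ ⟨A, hA, B, hB, rfl⟩
      exact key A B hA hB
    · simpa using key univ univ .univ .univ
  have hf₁ : IsFiniteMeasure (volume.restrict Q₁) := ⟨by simpa using hv₁.lt_top⟩
  have hf₂ : IsFiniteMeasure (volume.restrict Q₂) := ⟨by simpa using hv₂.lt_top⟩
  have hf₃ : IsFiniteMeasure (volume.restrict Q₃) := ⟨by simpa using hv₃.lt_top⟩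
  have heq : ((lam ^ 3) • ((volume.restrict Q₁).prod (volume.restrict Q₂))).prod
      (volume.restrict Q₃) = P.bind κ := by
    refine Measure.prod_eq fun A B hA hB => ?_
    rw [Measure.bind_apply (hA.prod hB) hκm.aemeasurable]
    simp only [hκ, Measure.prod_prod, pointMeasure_apply (h₃ _) hB,
      pointMeasure_prod_apply (h₁ _) (h₂ _) hA]
    have hmean := hΦ.lintegral_encard (hQ₃.inter hB)
      (fun ω => (h₃ ω).subset (inter_subset_inter_right _ inter_subset_left))
      (measure_ne_top_of_subset inter_subset_left hv₃)
    have h := hΦ.lintegral_pair hQ₁ hQ₂ (hQ₃.inter hB) h₁ h₂ hv₁ hv₂ h12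
      (h13.mono_right inter_subset_left) (h23.mono_right inter_subset_left)
      (fun n => (n : ℝ≥0∞)) (by
        rw [hmean]
        have := measure_ne_top_of_subset (μ := volume) (inter_subset_left (s := Q₃) (t := B)) hv₃
        finiteness) hA
    rw [hmean] at h
    simp only [mul_comm] at h ⊢
    rw [h, Measure.prod_restrict, Measure.smul_apply, Measure.restrict_apply hA,
      Measure.restrict_apply hB, inter_comm Q₃, ← Measure.volume_eq_prod, ENNReal.smul_def,
      smul_eq_mul]
    push_cast
    ring
  have h0 : (P.bind κ) D = 0 := by
    rw [← heq, Measure.prod_restrict, Measure.prod_smul_left, Measure.prod_restrict]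
    simp only [Measure.smul_apply]
    rw [Measure.restrict_apply hDm]
    have : ((volume.prod volume).prod volume) (D ∩ (Q₁ ×ˢ Q₂) ×ˢ Q₃) = 0 :=
      measure_mono_null inter_subset_left hD
    rw [this, smul_zero]
  rw [Measure.bind_apply hDm hκm.aemeasurable,
    lintegral_eq_zero_iff (Measure.measurable_measure.1 hκm D hDm)] at h0
  filter_upwards [h0] with ω hω x hx y hy w hw hmem
  -- A triple of points in `D` would carry mass `1`, but `κ ω D = 0`.
  have hle : κ ω (({x} ×ˢ {y}) ×ˢ {w}) ≤ κ ω D := by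
    refine measure_mono ?_
    rintro ⟨⟨_, _⟩, _⟩ ⟨⟨rfl, rfl⟩, rfl⟩
    exact hmem
  have h1 : ∀ (Q : Set E3) (z : E3), (Φ ω ∩ Q).Finite → z ∈ Φ ω ∩ Q →
      pointMeasure (Φ ω) Q {z} = 1 := by
    intro Q z hf hz
    rw [pointMeasure_apply hf (measurableSet_singleton z), ← inter_assoc,
      inter_eq_right.2 (singleton_subset_iff.2 hz)]
    simp
  rw [hω, hκ, Measure.prod_prod, Measure.prod_prod, h1 _ _ (h₁ ω) hx, h1 _ _ (h₂ ω) hy,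
    h1 _ _ (h₃ ω) hw] at hle
  simp at hle

lemma IsPoissonProcess.ae_forall_triple (hΦ : IsPoissonProcess P Φ lam) [IsProbabilityMeasure P]
    (hlf : ∀ ω, ∀ R : ℝ, (Φ ω ∩ Metric.closedBall 0 R).Finite) {D : Set ((E3 × E3) × E3)}
    (hD : volume D = 0) :
    ∀ᵐ ω ∂P, ∀ x ∈ Φ ω, ∀ y ∈ Φ ω, ∀ w ∈ Φ ω, x ≠ y → x ≠ w → y ≠ w → ((x, y), w) ∉ D := by
  have : ∀ᵐ ω ∂P, ∀ N K : ℕ, ∀ a ∈ ((simpleApprox N).range : Set E3),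
      ∀ b ∈ ((simpleApprox N).range : Set E3), ∀ c ∈ ((simpleApprox N).range : Set E3),
      a ≠ b → a ≠ c → b ≠ c → ∀ x ∈ Φ ω ∩ cell (simpleApprox N) K a,
      ∀ y ∈ Φ ω ∩ cell (simpleApprox N) K b, ∀ w ∈ Φ ω ∩ cell (simpleApprox N) K c,
      ((x, y), w) ∉ toMeasurable volume D := by
    refine ae_all_iff.2 fun N => ae_all_iff.2 fun K => ?_
    refine (ae_ball_iff (Finset.countable_toSet _)).2 fun a _ => ?_
    refine (ae_ball_iff (Finset.countable_toSet _)).2 fun b _ => ?_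
    refine (ae_ball_iff (Finset.countable_toSet _)).2 fun c _ => ?_
    by_cases hab : a = b
    · simp [hab]
    by_cases hac : a = c
    · simp [hac]
    by_cases hbc : b = c
    · simp [hbc]
    have h := hΦ.ae_triple_cell (measurableSet_cell (simpleApprox N) K a)
      (measurableSet_cell (simpleApprox N) K b) (measurableSet_cell (simpleApprox N) K c)
      (fun ω => finite_inter_cell (hlf ω) _ _ _) (fun ω => finite_inter_cell (hlf ω) _ _ _)
      (fun ω => finite_inter_cell (hlf ω) _ _ _) (volume_cell_ne_top _ _ _)
      (volume_cell_ne_top _ _ _) (volume_cell_ne_top _ _ _) (disjoint_cell _ _ hab)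
      (disjoint_cell _ _ hac) (disjoint_cell _ _ hbc) (measurableSet_toMeasurable volume D)
      ((measure_toMeasurable D).trans hD)
    filter_upwards [h] with ω hω _ _ _
    exact hω
  filter_upwards [this] with ω hω x hx y hy w hw hxy hxw hyw hmem
  obtain ⟨N, hN1, hN2, hN3⟩ := ((eventually_simpleApprox_ne hxy).and
    ((eventually_simpleApprox_ne hxw).and (eventually_simpleApprox_ne hyw))).exists
  obtain ⟨K, hK⟩ := exists_nat_ge (max ‖x‖ (max ‖y‖ ‖w‖))
  have hK' := max_le_iff.1 hK
  have hK'' := max_le_iff.1 hK'.2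
  exact hω N K _ (SimpleFunc.mem_range_self _ x) _ (SimpleFunc.mem_range_self _ y) _
    (SimpleFunc.mem_range_self _ w) hN1 hN2 hN3 x ⟨hx, rfl, by simpa using hK'.1⟩
    y ⟨hy, rfl, by simpa using hK''.1⟩ w ⟨hw, rfl, by simpa using hK''.2⟩
    (subset_toMeasurable _ _ hmem)

end Factorial

/-! ### Discretisation of the count of pairs with an empty ball -/

section Mecke

variable {Ω : Type*} [MeasurableSpace Ω] {P : Measure Ω} {Φ : Ω → Set E3} {lam : ℝ≥0}

/-- The pairs of points of `φ` in `C` such that `φ` has no point in the open ball attached to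
the pair. -/
def emptyBallPairs (φ : Set E3) (C : Set (E3 × E3)) (c : E3 × E3 → E3) (R : E3 × E3 → ℝ) :
    Set (E3 × E3) :=
  {q | q ∈ C ∧ q.1 ∈ φ ∧ q.2 ∈ φ ∧ φ ∩ Metric.ball (c q) (R q) = ∅}

open Classical in
/-- The number of pairs of points in `C`, in distinct cells, such that the set attached to
the pair of cells is empty. -/
def discreteCount (φ : Set E3) (C : Set (E3 × E3)) (u : E3 × E3 → Set E3)
    (q : SimpleFunc E3 E3) (K : ℕ) : ℝ≥0∞ :=
  ∑ ab ∈ q.range.offDiag, (if (φ ∩ u ab).encard = 0 then 1 else 0) *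
    ((((φ ∩ cell q K ab.1) ×ˢ (φ ∩ cell q K ab.2) ∩ C).encard : ℕ∞) : ℝ≥0∞)

lemma measurable_discreteCount (hΦ : IsPoissonProcess P Φ lam)
    (hlf : ∀ ω, ∀ R : ℝ, (Φ ω ∩ Metric.closedBall 0 R).Finite) {C : Set (E3 × E3)}
    (hC : MeasurableSet C) {u : E3 × E3 → Set E3} (hu : ∀ ab, MeasurableSet (u ab))
    (q : SimpleFunc E3 E3) (K : ℕ) : Measurable fun ω => discreteCount (Φ ω) C u q K := by
  classical
  unfold discreteCount
  refine Finset.measurable_sum _ fun ab _ => Measurable.mul ?_ ?_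
  · exact (Measurable.of_discrete (f := fun n : ℕ∞ => if n = 0 then (1 : ℝ≥0∞) else 0)).comp
      (hΦ.measurable_count _ (hu ab))
  · simp only [← pointMeasure_prod_apply (finite_inter_cell (hlf _) q K _)
      (finite_inter_cell (hlf _) q K _) hC]
    exact Measure.measurable_measure.1 (measurable_pointMeasure_prod hΦ (measurableSet_cell _ _ _)
      (measurableSet_cell _ _ _) (fun ω => finite_inter_cell (hlf _) q K _)
      (fun ω => finite_inter_cell (hlf _) q K _)) C hC

open Classical in
-- Since `u ab` avoids the two cells of `ab`, its emptiness is independent of the counts in them.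
-- This is the Mecke formula in discrete form. By `hCK`, cutting the cells off at distance `K` loses
-- no pair of `C`.
lemma lintegral_discreteCount (hΦ : IsPoissonProcess P Φ lam) [IsProbabilityMeasure P]
    (hlf : ∀ ω, ∀ R : ℝ, (Φ ω ∩ Metric.closedBall 0 R).Finite) {C : Set (E3 × E3)}
    (hC : MeasurableSet C) {K : ℕ}
    (hCK : C ⊆ Metric.closedBall 0 K ×ˢ Metric.closedBall 0 K)
    {u : E3 × E3 → Set E3} (hu : ∀ ab, MeasurableSet (u ab)) (huv : ∀ ab, volume (u ab) ≠ ∞)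
    (q : SimpleFunc E3 E3) (hdisj : ∀ ab, Disjoint (u ab) (q ⁻¹' {ab.1} ∪ q ⁻¹' {ab.2})) :
    ∫⁻ ω, discreteCount (Φ ω) C u q K ∂P = lam ^ 2 * ∫⁻ x in C,
      if q x.1 ≠ q x.2 then voidProb lam (u (q x.1, q x.2)) else 0 := by
  have hcell : ∀ ab : E3 × E3, MeasurableSet (cell q K ab.1 ×ˢ cell q K ab.2) := fun ab =>
    (measurableSet_cell _ _ _).prod (measurableSet_cell _ _ _)
  have hpt : ∀ x ∈ C, (if q x.1 ≠ q x.2 then voidProb lam (u (q x.1, q x.2)) else 0) =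
      ∑ ab ∈ q.range.offDiag, (cell q K ab.1 ×ˢ cell q K ab.2).indicator
        (fun _ => voidProb lam (u ab)) x := by
    intro x hx
    have hmem : ∀ ab : E3 × E3, x ∈ cell q K ab.1 ×ˢ cell q K ab.2 ↔ (q x.1, q x.2) = ab := by
      rintro ⟨a, b⟩
      have := hCK hx
      simp only [cell, mem_prod, mem_inter_iff, mem_preimage, mem_singleton_iff,
        Prod.mk.injEq] at this ⊢
      tauto
    simp only [indicator, hmem]
    rw [Finset.sum_ite_eq]
    simp
  rw [setLIntegral_congr_fun hC hpt, lintegral_finsetSum _ fun ab _ =>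
    measurable_const.indicator (hcell ab), Finset.mul_sum]
  unfold discreteCount
  rw [lintegral_finsetSum']
  · refine Finset.sum_congr rfl fun ab hab => ?_
    have hne : ab.1 ≠ ab.2 := (Finset.mem_offDiag.1 hab).2.2
    have hd := disjoint_union_right.1 (hdisj ab)
    have := hΦ.lintegral_pair (measurableSet_cell q K ab.1) (measurableSet_cell q K ab.2)
      (hu ab) (fun ω => finite_inter_cell (hlf _) q K _) (fun ω => finite_inter_cell (hlf _) q K _)
      (volume_cell_ne_top _ _ _) (volume_cell_ne_top _ _ _) (disjoint_cell _ _ hne)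
      (hd.1.symm.mono_left inter_subset_left) (hd.2.symm.mono_left inter_subset_left)
      (fun n => if n = 0 then 1 else 0)
      (by rw [hΦ.lintegral_void (hu ab) (huv ab)]; exact voidProb_ne_top _ _) hC
    rw [this, hΦ.lintegral_void (hu ab) (huv ab), lintegral_indicator_const (hcell ab),
      Measure.restrict_apply (hcell ab), inter_comm C]
    ring
  · intro ab _
    refine Measurable.aemeasurable (Measurable.mul ?_ ?_)
    · exact (Measurable.of_discrete (f := fun n : ℕ∞ => if n = 0 then (1 : ℝ≥0∞) else 0)).comp
        (hΦ.measurable_count _ (hu ab))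
    · simp only [← pointMeasure_prod_apply (finite_inter_cell (hlf _) q K _)
        (finite_inter_cell (hlf _) q K _) hC]
      exact Measure.measurable_measure.1 (measurable_pointMeasure_prod hΦ
        (measurableSet_cell _ _ _)
        (measurableSet_cell _ _ _) (fun ω => finite_inter_cell (hlf _) q K _)
        (fun ω => finite_inter_cell (hlf _) q K _)) C hC

open Classical in
-- Every pair of points lies in exactly one pair of cells, so the sum over cells can be reorganised
-- as a sum over points. The finite set `T` of pairs does not depend on the discretisation, so it
-- stays fixed under refinement.
lemma discreteCount_eq_sum {φ : Set E3}
    {C : Set (E3 × E3)} {K : ℕ} (hCK : C ⊆ Metric.closedBall 0 K ×ˢ Metric.closedBall 0 K)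
    (u : E3 × E3 → Set E3) (q : SimpleFunc E3 E3)
    (T : Finset (E3 × E3)) (hT : ∀ x, x ∈ T ↔ x ∈ C ∧ x.1 ∈ φ ∧ x.2 ∈ φ) :
    discreteCount φ C u q K =
      ∑ x ∈ T, if q x.1 ≠ q x.2 ∧ φ ∩ u (q x.1, q x.2) = ∅ then 1 else 0 := by
  have h1 : ∀ ab : E3 × E3, ((((φ ∩ cell q K ab.1) ×ˢ (φ ∩ cell q K ab.2) ∩ C).encard : ℕ∞) : ℝ≥0∞)
      = ∑ x ∈ T, if (q x.1, q x.2) = ab then 1 else 0 := by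
    rintro ⟨a, b⟩
    have : (φ ∩ cell q K a) ×ˢ (φ ∩ cell q K b) ∩ C =
        (T.filter fun x => (q x.1, q x.2) = (a, b) : Finset (E3 × E3)) := by
      ext x
      have h2 := @hCK x
      simp only [cell, mem_prod, mem_inter_iff, mem_preimage, mem_singleton_iff, Finset.coe_filter,
        mem_ofPred_eq, hT, Prod.mk.injEq] at h2 ⊢
      tauto
    simp only [this, Set.encard_coe_eq_coe_finsetCard, Finset.card_filter, ENat.toENNReal_coe]
    push_cast
    rfl
  unfold discreteCount
  simp only [h1, Finset.mul_sum]
  rw [Finset.sum_comm]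
  refine Finset.sum_congr rfl fun x _ => ?_
  simp only [mul_ite, mul_one, mul_zero]
  rw [Finset.sum_ite_eq]
  simp only [Finset.mem_offDiag, SimpleFunc.mem_range_self, true_and, encard_eq_zero]
  by_cases h : q x.1 = q x.2 <;> simp [h]

/-- The set attached to a pair of cells. -/
def discreteBall (c : E3 × E3 → E3) (R : E3 × E3 → ℝ) (q : SimpleFunc E3 E3) (ab : E3 × E3) :
    Set E3 :=
  Metric.ball (c ab) (R ab) \ (q ⁻¹' {ab.1} ∪ q ⁻¹' {ab.2})

/-- The points of the pair lie on the sphere, so not in the open ball, and they lie in the removed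
cells, so not in the discrete ball either. Any other `w` is strictly inside or strictly outside,
which survives small changes of centre and radius. -/
lemma eventually_mem_discreteBall_iff {c : E3 × E3 → E3} {R : E3 × E3 → ℝ} {x : E3 × E3}
    (hc : ContinuousAt c x) (hR : ContinuousAt R x) (h₁ : dist x.1 (c x) = R x)
    (h₂ : dist x.2 (c x) = R x) {w : E3} (hw : w ≠ x.1 → w ≠ x.2 → dist w (c x) ≠ R x) :
    ∀ᶠ N in Filter.atTop, w ∈ discreteBall c R (simpleApprox N)
      (simpleApprox N x.1, simpleApprox N x.2) ↔ w ∈ Metric.ball (c x) (R x) := by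
  by_cases hw1 : w = x.1
  · subst hw1
    refine Filter.Eventually.of_forall fun N => ?_
    simp [discreteBall, h₁]
  by_cases hw2 : w = x.2
  · subst hw2
    refine Filter.Eventually.of_forall fun N => ?_
    simp [discreteBall, h₂]
  have hlim : Filter.Tendsto (fun N => (simpleApprox N x.1, simpleApprox N x.2)) Filter.atTop
      (nhds x) := (tendsto_simpleApprox x.1).prodMk_nhds (tendsto_simpleApprox x.2)
  have hd : Filter.Tendsto (fun N => dist w (c (simpleApprox N x.1, simpleApprox N x.2)))
      Filter.atTop (nhds (dist w (c x))) := tendsto_const_nhds.dist (hc.tendsto.comp hlim)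
  have hR' := hR.tendsto.comp hlim
  have hball : ∀ᶠ N in Filter.atTop, (dist w (c (simpleApprox N x.1, simpleApprox N x.2)) <
      R (simpleApprox N x.1, simpleApprox N x.2) ↔ dist w (c x) < R x) := by
    rcases lt_or_gt_of_ne (hw hw1 hw2) with h | h
    · filter_upwards [hd.eventually_lt hR' h] with N hN
      exact iff_of_true hN h
    · filter_upwards [hR'.eventually_lt hd h] with N hN
      exact iff_of_false hN.not_gt h.not_gt
  filter_upwards [hball, eventually_simpleApprox_ne hw1, eventually_simpleApprox_ne hw2]
    with N h h1 h2
  simp [discreteBall, h, h1, h2]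

/-- A common bounded window serves twice: only finitely many points of a locally finite
configuration need testing, and the volumes converge. -/
lemma eventually_discreteBall_subset {c : E3 × E3 → E3} {R : E3 × E3 → ℝ} {x : E3 × E3}
    (hc : ContinuousAt c x) (hR : ContinuousAt R x) :
    ∃ r : ℝ, Metric.ball (c x) (R x) ⊆ Metric.closedBall 0 r ∧ ∀ᶠ N in Filter.atTop,
      discreteBall c R (simpleApprox N) (simpleApprox N x.1, simpleApprox N x.2) ⊆
        Metric.closedBall 0 r := by
  have hlim : Filter.Tendsto (fun N => (simpleApprox N x.1, simpleApprox N x.2)) Filter.atTop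
      (nhds x) := (tendsto_simpleApprox x.1).prodMk_nhds (tendsto_simpleApprox x.2)
  have hball : ∀ (y : E3) (s r : ℝ), ‖y‖ + s < r → Metric.ball y s ⊆ Metric.closedBall 0 r := by
    intro y s r h w hw
    rw [mem_closedBall_zero_iff]
    rw [Metric.mem_ball, dist_eq_norm] at hw
    have := norm_le_norm_add_norm_sub' w y
    linarith
  refine ⟨‖c x‖ + R x + 1, hball _ _ _ (by linarith), ?_⟩
  have h : Filter.Tendsto (fun N => ‖c (simpleApprox N x.1, simpleApprox N x.2)‖ +
      R (simpleApprox N x.1, simpleApprox N x.2)) Filter.atTop (nhds (‖c x‖ + R x)) :=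
    (hc.tendsto.comp hlim).norm.add (hR.tendsto.comp hlim)
  filter_upwards [h.eventually_lt_const (lt_add_one _)] with N hN
  exact sdiff_subset.trans (hball _ _ _ hN)

lemma finite_pairs_inter {φ : Set E3} (hφ : ∀ R : ℝ, (φ ∩ Metric.closedBall 0 R).Finite)
    {C : Set (E3 × E3)} {K : ℕ} (hCK : C ⊆ Metric.closedBall 0 K ×ˢ Metric.closedBall 0 K) :
    {x | x ∈ C ∧ x.1 ∈ φ ∧ x.2 ∈ φ}.Finite := by
  refine ((hφ K).prod (hφ K)).subset fun x hx => ?_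
  have := hCK hx.1
  exact ⟨⟨hx.2.1, this.1⟩, hx.2.2, this.2⟩

lemma tendsto_volume_discreteBall {c : E3 × E3 → E3} {R : E3 × E3 → ℝ} {x : E3 × E3}
    (hc : ContinuousAt c x) (hR : ContinuousAt R x) (h₁ : dist x.1 (c x) = R x)
    (h₂ : dist x.2 (c x) = R x) :
    Filter.Tendsto (fun N => volume (discreteBall c R (simpleApprox N)
      (simpleApprox N x.1, simpleApprox N x.2))) Filter.atTop
      (nhds (volume (Metric.ball (c x) (R x)))) := by
  obtain ⟨r, _, hr⟩ := eventually_discreteBall_subset hc hR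
  refine tendsto_measure_of_ae_tendsto_indicator Filter.atTop measurableSet_ball (fun N => ?_)
    (Metric.isClosed_closedBall (x := (0 : E3)) (ε := r)).measurableSet
    measure_closedBall_lt_top.ne hr ?_
  · exact measurableSet_ball.diff ((SimpleFunc.measurableSet_fiber _ _).union
      (SimpleFunc.measurableSet_fiber _ _))
  · have h0 : ∀ᵐ w ∂(volume : Measure E3), w ∉ Metric.sphere (c x) (R x) :=
      measure_eq_zero_iff_ae_notMem.1 (Measure.addHaar_sphere volume _ _)
    filter_upwards [h0] with w hw
    exact eventually_mem_discreteBall_iff hc hR h₁ h₂ (fun _ _ => hw)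

lemma measurableSet_discreteBall (c : E3 × E3 → E3) (R : E3 × E3 → ℝ) (q : SimpleFunc E3 E3)
    (ab : E3 × E3) : MeasurableSet (discreteBall c R q ab) :=
  measurableSet_ball.diff ((SimpleFunc.measurableSet_fiber _ _).union
    (SimpleFunc.measurableSet_fiber _ _))

open Classical in
-- Finitely many pairs, and finitely many points to test for each, so all the eventual equivalences
-- hold at once and the counts are eventually equal.
lemma eventually_discreteCount_eq {φ : Set E3}
    (hφ : ∀ R : ℝ, (φ ∩ Metric.closedBall 0 R).Finite)
    {C : Set (E3 × E3)} {K : ℕ} (hCK : C ⊆ Metric.closedBall 0 K ×ˢ Metric.closedBall 0 K)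
    {c : E3 × E3 → E3} {R : E3 × E3 → ℝ} (hC2 : ∀ x ∈ C, x.1 ≠ x.2)
    (hc : ∀ x ∈ C, ContinuousAt c x) (hR : ∀ x ∈ C, ContinuousAt R x)
    (h₁ : ∀ x ∈ C, dist x.1 (c x) = R x) (h₂ : ∀ x ∈ C, dist x.2 (c x) = R x)
    (hsph : ∀ x ∈ C, x.1 ∈ φ → x.2 ∈ φ → ∀ w ∈ φ, w ≠ x.1 → w ≠ x.2 → dist w (c x) ≠ R x) :
    ∀ᶠ N in Filter.atTop, discreteCount φ C (discreteBall c R (simpleApprox N)) (simpleApprox N) K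
      = (((emptyBallPairs φ C c R).encard : ℕ∞) : ℝ≥0∞) := by
  have hfin := finite_pairs_inter hφ hCK
  set T := hfin.toFinset with hTdef
  have hT : ∀ x, x ∈ T ↔ x ∈ C ∧ x.1 ∈ φ ∧ x.2 ∈ φ := fun x => by
    rw [hTdef, Finite.mem_toFinset]; rfl
  have h3 : ∀ x ∈ T, ∀ᶠ N in Filter.atTop, (simpleApprox N x.1 ≠ simpleApprox N x.2 ∧
      φ ∩ discreteBall c R (simpleApprox N) (simpleApprox N x.1, simpleApprox N x.2) = ∅ ↔
      φ ∩ Metric.ball (c x) (R x) = ∅) := by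
    intro x hx
    obtain ⟨hxC, hx1, hx2⟩ := (hT x).1 hx
    obtain ⟨r, hr1, hr2⟩ := eventually_discreteBall_subset (hc x hxC) (hR x hxC)
    have h4 : ∀ᶠ N in Filter.atTop, ∀ w ∈ φ ∩ Metric.closedBall 0 r,
        (w ∈ discreteBall c R (simpleApprox N) (simpleApprox N x.1, simpleApprox N x.2) ↔
          w ∈ Metric.ball (c x) (R x)) := by
      refine (hφ r).eventually_all.2 fun w hw => ?_
      exact eventually_mem_discreteBall_iff (hc x hxC) (hR x hxC) (h₁ x hxC) (h₂ x hxC)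
        (hsph x hxC hx1 hx2 w hw.1)
    filter_upwards [h4, hr2, eventually_simpleApprox_ne (hC2 x hxC)] with N h4 h5 h6
    simp only [h6, ne_eq, not_false_eq_true, true_and, eq_empty_iff_forall_notMem, mem_inter_iff,
      not_and]
    refine forall₂_congr fun w hw => not_congr ⟨fun h => (h4 w ⟨hw, h5 h⟩).1 h,
      fun h => (h4 w ⟨hw, hr1 h⟩).2 h⟩
  filter_upwards [(Filter.eventually_all_finset T).2 h3] with N hN
  rw [discreteCount_eq_sum hCK _ _ T hT]
  have : emptyBallPairs φ C c R
      = (T.filter fun x => φ ∩ Metric.ball (c x) (R x) = ∅ : Finset (E3 × E3)) := by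
    ext x
    simp [emptyBallPairs, hT, and_assoc]
  rw [this, Set.encard_coe_eq_coe_finsetCard, Finset.card_filter, ENat.toENNReal_coe]
  push_cast
  refine Finset.sum_congr rfl fun x hx => ?_
  simp only [hN x hx]

end Mecke

/-! ### The Mecke formula for pairs with an empty ball -/

section MeckeFormula

variable {Ω : Type*} [MeasurableSpace Ω] {P : Measure Ω} {Φ : Ω → Set E3} {lam : ℝ≥0}

/-- Supplies the dominating function for the limit below. Attaching the empty set to each pair of
cells turns the discrete formula into the bound `λ² |C|`, and Fatou's lemma passes to the limit. -/
lemma IsPoissonProcess.lintegral_pairs_lt_top (hΦ : IsPoissonProcess P Φ lam)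
    [IsProbabilityMeasure P]
    (hlf : ∀ ω, ∀ R : ℝ, (Φ ω ∩ Metric.closedBall 0 R).Finite) {C : Set (E3 × E3)}
    (hC : MeasurableSet C) {K : ℕ}
    (hCK : C ⊆ Metric.closedBall 0 K ×ˢ Metric.closedBall 0 K) (hC2 : ∀ x ∈ C, x.1 ≠ x.2) :
    ∫⁻ ω, ((({x | x ∈ C ∧ x.1 ∈ Φ ω ∧ x.2 ∈ Φ ω}.encard : ℕ∞)) : ℝ≥0∞) ∂P < ∞ := by
  classical
  have hvol : volume C < ∞ := by
    refine (measure_mono hCK).trans_lt ?_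
    rw [Measure.volume_eq_prod, Measure.prod_prod]
    exact ENNReal.mul_lt_top measure_closedBall_lt_top measure_closedBall_lt_top
  have hlim : ∀ ω, Filter.liminf (fun N => discreteCount (Φ ω) C (fun _ => ∅) (simpleApprox N) K)
      Filter.atTop = ((({x | x ∈ C ∧ x.1 ∈ Φ ω ∧ x.2 ∈ Φ ω}.encard : ℕ∞)) : ℝ≥0∞) := by
    intro ω
    refine Filter.Tendsto.liminf_eq (tendsto_nhds_of_eventually_eq ?_)
    have hfin := finite_pairs_inter (hlf ω) hCK
    have hT : ∀ x, x ∈ hfin.toFinset ↔ x ∈ C ∧ x.1 ∈ Φ ω ∧ x.2 ∈ Φ ω := fun x => by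
      rw [Finite.mem_toFinset]; rfl
    have h3 : ∀ x ∈ hfin.toFinset, ∀ᶠ N in Filter.atTop,
        simpleApprox N x.1 ≠ simpleApprox N x.2 := fun x hx =>
      eventually_simpleApprox_ne (hC2 x ((hT x).1 hx).1)
    filter_upwards [(Filter.eventually_all_finset _).2 h3] with N hN
    rw [discreteCount_eq_sum hCK _ _ _ hT, ← hfin.cast_ncard_eq, ENat.toENNReal_coe,
      ncard_eq_toFinset_card _ hfin, Finset.sum_congr rfl (g := fun _ => 1)]
    · simp
    · intro x hx
      simp [hN x hx]
  simp only [← hlim]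
  refine (lintegral_liminf_le fun N => measurable_discreteCount hΦ hlf hC
    (fun _ => MeasurableSet.empty) (simpleApprox N) K).trans_lt ?_
  have hbound : ∀ N, ∫⁻ ω, discreteCount (Φ ω) C (fun _ => ∅) (simpleApprox N) K ∂P
      ≤ lam ^ 2 * volume C := by
    intro N
    rw [lintegral_discreteCount hΦ hlf hC hCK (fun _ => MeasurableSet.empty) (by simp)
      (simpleApprox N) (by simp)]
    gcongr
    refine (setLIntegral_mono measurable_const (g := fun _ => 1) fun x _ => ?_).trans (by simp)
    split_ifs <;> simp [voidProb_le_one]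
  refine (Filter.liminf_le_of_le (by isBoundedDefault)
    (fun b hb => ?_)).trans_lt (b := lam ^ 2 * volume C) ?_
  · obtain ⟨N, hN⟩ := hb.exists
    exact hN.trans (hbound N)
  · finiteness

/-- Dominated convergence on both sides of the discrete formula. Measurability of the count is not
among the hypotheses on `Φ`; it is obtained here as that of an almost sure limit, and monotone
convergence needs it below. -/
lemma IsPoissonProcess.lintegral_emptyBallPairs_of_bounded (hΦ : IsPoissonProcess P Φ lam)
    [IsProbabilityMeasure P]
    (hlf : ∀ ω, ∀ R : ℝ, (Φ ω ∩ Metric.closedBall 0 R).Finite) {C : Set (E3 × E3)}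
    (hC : MeasurableSet C) {K : ℕ}
    (hCK : C ⊆ Metric.closedBall 0 K ×ˢ Metric.closedBall 0 K)
    {c : E3 × E3 → E3} {R : E3 × E3 → ℝ} (hC2 : ∀ x ∈ C, x.1 ≠ x.2)
    (hc : ∀ x ∈ C, ContinuousAt c x) (hR : ∀ x ∈ C, ContinuousAt R x)
    (h₁ : ∀ x ∈ C, dist x.1 (c x) = R x) (h₂ : ∀ x ∈ C, dist x.2 (c x) = R x)
    (hsph : ∀ᵐ ω ∂P, ∀ x ∈ C, x.1 ∈ Φ ω → x.2 ∈ Φ ω →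
      ∀ w ∈ Φ ω, w ≠ x.1 → w ≠ x.2 → dist w (c x) ≠ R x) :
    AEMeasurable (fun ω => (((emptyBallPairs (Φ ω) C c R).encard : ℕ∞) : ℝ≥0∞)) P ∧
    ∫⁻ ω, (((emptyBallPairs (Φ ω) C c R).encard : ℕ∞) : ℝ≥0∞) ∂P =
      lam ^ 2 * ∫⁻ x in C, voidProb lam (Metric.ball (c x) (R x)) := by
  classical
  have hvol : volume C < ∞ := by
    refine (measure_mono hCK).trans_lt ?_
    rw [Measure.volume_eq_prod, Measure.prod_prod]
    exact ENNReal.mul_lt_top measure_closedBall_lt_top measure_closedBall_lt_top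
  set F : ℕ → Ω → ℝ≥0∞ := fun N ω =>
    discreteCount (Φ ω) C (discreteBall c R (simpleApprox N)) (simpleApprox N) K with hF
  have hFm : ∀ N, Measurable (F N) := fun N => measurable_discreteCount hΦ hlf hC
    (measurableSet_discreteBall c R _) (simpleApprox N) K
  have hFlim : ∀ᵐ ω ∂P, Filter.Tendsto (fun N => F N ω) Filter.atTop
      (nhds (((emptyBallPairs (Φ ω) C c R).encard : ℕ∞) : ℝ≥0∞)) := by
    filter_upwards [hsph] with ω hω
    exact tendsto_nhds_of_eventually_eq
      (eventually_discreteCount_eq (hlf ω) hCK hC2 hc hR h₁ h₂ hω)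
  refine ⟨aemeasurable_of_tendsto_metrizable_ae Filter.atTop (fun N => (hFm N).aemeasurable) hFlim,
    ?_⟩
  have hFle : ∀ N ω, F N ω ≤ ((({x | x ∈ C ∧ x.1 ∈ Φ ω ∧ x.2 ∈ Φ ω}.encard : ℕ∞)) : ℝ≥0∞) := by
    intro N ω
    have hfin := finite_pairs_inter (hlf ω) hCK
    have hT : ∀ x, x ∈ hfin.toFinset ↔ x ∈ C ∧ x.1 ∈ Φ ω ∧ x.2 ∈ Φ ω := fun x => by
      rw [Finite.mem_toFinset]; rfl
    rw [hF]
    simp only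
    rw [discreteCount_eq_sum hCK _ _ _ hT, ← hfin.cast_ncard_eq, ENat.toENNReal_coe,
      ncard_eq_toFinset_card _ hfin]
    refine (Finset.sum_le_sum (g := fun _ => 1) fun x hx => ?_).trans (by simp)
    split_ifs <;> simp
  have hlim1 := tendsto_lintegral_of_dominated_convergence _ hFm (fun N => ae_of_all _ (hFle N))
    (hΦ.lintegral_pairs_lt_top hlf hC hCK hC2).ne hFlim
  have hint : ∀ N, ∫⁻ ω, F N ω ∂P = lam ^ 2 * ∫⁻ x in C,
      if simpleApprox N x.1 ≠ simpleApprox N x.2 then voidProb lam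
        (discreteBall c R (simpleApprox N) (simpleApprox N x.1, simpleApprox N x.2)) else 0 :=
    fun N => lintegral_discreteCount hΦ hlf hC hCK (measurableSet_discreteBall c R _)
      (fun ab => measure_ne_top_of_subset sdiff_subset measure_ball_lt_top.ne) (simpleApprox N)
      (fun ab => disjoint_sdiff_left)
  simp only [hint] at hlim1
  refine tendsto_nhds_unique hlim1 (ENNReal.Tendsto.const_mul ?_ (Or.inr (by finiteness)))
  refine tendsto_lintegral_of_dominated_convergence (fun _ => 1) (fun N => ?_)
    (fun N => ae_of_all _ fun x => ?_) (by simpa using hvol.ne) ?_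
  · have : (fun x : E3 × E3 => if simpleApprox N x.1 ≠ simpleApprox N x.2 then voidProb lam
        (discreteBall c R (simpleApprox N) (simpleApprox N x.1, simpleApprox N x.2)) else 0) =
        (fun ab : E3 × E3 => if ab.1 ≠ ab.2 then voidProb lam
          (discreteBall c R (simpleApprox N) ab) else 0) ∘
        (((simpleApprox N).comp Prod.fst measurable_fst).pair
          ((simpleApprox N).comp Prod.snd measurable_snd)) := rfl
    rw [this, ← SimpleFunc.coe_map]
    exact SimpleFunc.measurable _
  · dsimp only
    split_ifs <;> simp [voidProb_le_one]
  · refine (ae_restrict_iff' hC).2 (ae_of_all _ fun x hx => ?_)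
    have hv : Filter.Tendsto (fun N => voidProb lam (discreteBall c R (simpleApprox N)
        (simpleApprox N x.1, simpleApprox N x.2))) Filter.atTop
        (nhds (voidProb lam (Metric.ball (c x) (R x)))) := by
      refine ENNReal.tendsto_ofReal ((Real.continuous_exp.tendsto _).comp ?_)
      refine (Filter.Tendsto.const_mul _ ?_).neg
      exact (ENNReal.tendsto_toReal measure_ball_lt_top.ne).comp
        (tendsto_volume_discreteBall (hc x hx) (hR x hx) (h₁ x hx) (h₂ x hx))
    refine hv.congr' ?_
    filter_upwards [eventually_simpleApprox_ne (hC2 x hx)] with N hN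
    rw [if_pos hN]

/-- The Mecke formula for pairs of points with an empty ball. -/
lemma IsPoissonProcess.lintegral_emptyBallPairs (hΦ : IsPoissonProcess P Φ lam)
    [IsProbabilityMeasure P]
    (hlf : ∀ ω, ∀ R : ℝ, (Φ ω ∩ Metric.closedBall 0 R).Finite) {C : Set (E3 × E3)}
    (hC : MeasurableSet C)
    {c : E3 × E3 → E3} {R : E3 × E3 → ℝ} (hC2 : ∀ x ∈ C, x.1 ≠ x.2)
    (hc : ∀ x ∈ C, ContinuousAt c x) (hR : ∀ x ∈ C, ContinuousAt R x)
    (h₁ : ∀ x ∈ C, dist x.1 (c x) = R x) (h₂ : ∀ x ∈ C, dist x.2 (c x) = R x)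
    (hsph : ∀ᵐ ω ∂P, ∀ x ∈ C, x.1 ∈ Φ ω → x.2 ∈ Φ ω →
      ∀ w ∈ Φ ω, w ≠ x.1 → w ≠ x.2 → dist w (c x) ≠ R x) :
    ∫⁻ ω, (((emptyBallPairs (Φ ω) C c R).encard : ℕ∞) : ℝ≥0∞) ∂P =
      lam ^ 2 * ∫⁻ x in C, voidProb lam (Metric.ball (c x) (R x)) := by
  -- Exhaustion by bounded windows, with monotone convergence on both sides.
  set W : ℕ → Set (E3 × E3) := fun K => Metric.closedBall 0 K ×ˢ Metric.closedBall 0 K with hW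
  have hWmono : Monotone W := fun K L hKL => by
    have : (K : ℝ) ≤ L := by exact_mod_cast hKL
    exact prod_mono (Metric.closedBall_subset_closedBall this)
      (Metric.closedBall_subset_closedBall this)
  have hWm : ∀ K, MeasurableSet (W K) := fun K =>
    Metric.isClosed_closedBall.measurableSet.prod Metric.isClosed_closedBall.measurableSet
  have hWU : ⋃ K, W K = univ := by
    refine eq_univ_of_forall fun x => mem_iUnion.2 ?_
    obtain ⟨K, hK⟩ := exists_nat_ge (max ‖x.1‖ ‖x.2‖)
    exact ⟨K, by simpa using (le_max_left _ _).trans hK, by simpa using (le_max_right _ _).trans hK⟩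
  have hCU : C = ⋃ K, C ∩ W K := by rw [← inter_iUnion, hWU, inter_univ]
  have hCmono : Monotone fun K => C ∩ W K := fun K L h => inter_subset_inter_right _ (hWmono h)
  -- As values of a counting measure, the cardinalities are continuous from below.
  have hcount : ∀ (ω : Ω) (S : Set (E3 × E3)),
      (((emptyBallPairs (Φ ω) S c R).encard : ℕ∞) : ℝ≥0∞) =
        Measure.count (emptyBallPairs (Φ ω) S c R) := by
    intro ω S
    have hΦc : (Φ ω).Countable := by
      have : Φ ω = ⋃ K : ℕ, Φ ω ∩ Metric.closedBall 0 K := by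
        rw [← inter_iUnion, Metric.iUnion_closedBall_nat, inter_univ]
      rw [this]
      exact countable_iUnion fun K => (hlf ω K).countable
    have hsub : emptyBallPairs (Φ ω) S c R ⊆ Φ ω ×ˢ Φ ω := by
      intro x hx
      exact ⟨hx.2.1, hx.2.2.1⟩
    have := (hΦc.prod hΦc).mono hsub
    rw [Measure.count_apply this.measurableSet]
  have hmono : ∀ ω, Monotone fun K => emptyBallPairs (Φ ω) (C ∩ W K) c R := by
    intro ω K L h x hx
    exact ⟨hCmono h hx.1, hx.2⟩
  have hb := fun K => hΦ.lintegral_emptyBallPairs_of_bounded hlf (hC.inter (hWm K))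
    (K := K) inter_subset_right (fun x hx => hC2 x hx.1) (fun x hx => hc x hx.1)
    (fun x hx => hR x hx.1) (fun x hx => h₁ x hx.1) (fun x hx => h₂ x hx.1)
    (hsph.mono fun ω h x hx => h x (mem_of_mem_inter_left hx))
  have hsup : ∀ ω, (((emptyBallPairs (Φ ω) C c R).encard : ℕ∞) : ℝ≥0∞) =
      ⨆ K, (((emptyBallPairs (Φ ω) (C ∩ W K) c R).encard : ℕ∞) : ℝ≥0∞) := by
    intro ω
    simp only [hcount]
    rw [← (hmono ω).measure_iUnion]
    congr 1
    ext x
    have := hWU.symm ▸ mem_univ x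
    simp only [mem_iUnion, emptyBallPairs, mem_ofPred_eq, mem_inter_iff] at this ⊢
    obtain ⟨K, hK⟩ := this
    constructor
    · intro h
      exact ⟨K, ⟨h.1, hK⟩, h.2⟩
    · rintro ⟨_, h⟩
      exact ⟨h.1.1, h.2⟩
  simp only [hsup]
  rw [lintegral_iSup' (fun K => (hb K).1) (ae_of_all _ fun ω K L h => by
    simp only [hcount]; exact measure_mono (hmono ω h))]
  simp only [(hb _).2]
  rw [← ENNReal.mul_iSup]
  congr 1
  conv_rhs => rw [hCU]
  rw [setLIntegral_iUnion_of_directed _ (directed_of_isDirected_le hCmono)]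

end MeckeFormula

/-! ### Crossings as pairs of nuclei with an empty ball -/

section Geometry

/-- The abscissa of the intersection of the line with the bisector plane of a pair of points. -/
def bisectorAbscissa (p d : E3) (q : E3 × E3) : ℝ :=
  inner ℝ (q.2 - q.1) ((2⁻¹ : ℝ) • (q.1 + q.2) - p) / inner ℝ (q.2 - q.1) d

/-- The intersection of the line with the bisector plane of a pair of points. -/
def bisectorPoint (p d : E3) (q : E3 × E3) : E3 := linePoint p d (bisectorAbscissa p d q)

/-- The distance of the points of a pair from `bisectorPoint`. -/
def bisectorRadius (p d : E3) (q : E3 × E3) : ℝ := dist q.1 (bisectorPoint p d q)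

/-- Vectors `a`, `b` have equal norms iff `a + b ⊥ a - b`; along the line this is an affine equation
in `z` with leading coefficient proportional to `⟪y - x, d⟫`. -/
lemma dist_linePoint_eq_iff {p d x y : E3} (h : inner ℝ (y - x) d ≠ 0) (z : ℝ) :
    dist x (linePoint p d z) = dist y (linePoint p d z) ↔ z = bisectorAbscissa p d (x, y) := by
  rw [dist_eq_norm, dist_eq_norm, eq_comm, ← real_inner_add_sub_eq_zero_iff, bisectorAbscissa,
    eq_div_iff h]
  have e1 : y - linePoint p d z - (x - linePoint p d z) = y - x := by abel
  have e2 : y - linePoint p d z + (x - linePoint p d z) =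
      (2 : ℝ) • (((2⁻¹ : ℝ) • (x + y) - p) - z • d) := by
    rw [linePoint]
    module
  rw [e1, e2, real_inner_comm, inner_smul_right, inner_sub_right, inner_smul_right]
  constructor
  · intro h'
    linarith
  · intro h'
    rw [h']
    ring

lemma dist_bisectorPoint_snd {p d : E3} {q : E3 × E3} (h : inner ℝ (q.2 - q.1) d ≠ 0) :
    dist q.2 (bisectorPoint p d q) = bisectorRadius p d q :=
  ((dist_linePoint_eq_iff h _).2 rfl).symm

lemma continuousAt_bisectorAbscissa (p : E3) {d : E3} {q : E3 × E3}
    (h : inner ℝ (q.2 - q.1) d ≠ 0) : ContinuousAt (bisectorAbscissa p d) q := by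
  unfold bisectorAbscissa
  refine ContinuousAt.div ?_ ?_ h <;> fun_prop

lemma continuousAt_bisectorPoint (p : E3) {d : E3} {q : E3 × E3}
    (h : inner ℝ (q.2 - q.1) d ≠ 0) : ContinuousAt (bisectorPoint p d) q := by
  unfold bisectorPoint linePoint
  exact continuousAt_const.add ((continuousAt_bisectorAbscissa p h).smul continuousAt_const)

lemma continuousAt_bisectorRadius (p : E3) {d : E3} {q : E3 × E3}
    (h : inner ℝ (q.2 - q.1) d ≠ 0) : ContinuousAt (bisectorRadius p d) q := by
  unfold bisectorRadius
  exact continuousAt_fst.dist (continuousAt_bisectorPoint p h)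

lemma measurable_bisectorAbscissa (p d : E3) : Measurable (bisectorAbscissa p d) := by
  unfold bisectorAbscissa
  fun_prop

lemma measurable_bisectorPoint (p d : E3) : Measurable (bisectorPoint p d) := by
  unfold bisectorPoint linePoint
  exact measurable_const.add ((measurable_bisectorAbscissa p d).smul measurable_const)

lemma measurable_bisectorRadius (p d : E3) : Measurable (bisectorRadius p d) := by
  unfold bisectorRadius
  exact measurable_fst.dist (measurable_bisectorPoint p d)

/-- Configurations in general position with respect to the line and to the order. -/
structure IsGeneric (r : E3 → E3 → Prop) (p d : E3) (φ : Set E3) : Prop where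
  finite : ∀ R : ℝ, (φ ∩ Metric.closedBall 0 R).Finite
  inner_ne : ∀ x ∈ φ, ∀ y ∈ φ, x ≠ y → inner ℝ (y - x) d ≠ 0
  total : ∀ x ∈ φ, ∀ y ∈ φ, x ≠ y → r x y ∨ r y x
  sphere : ∀ x ∈ φ, ∀ y ∈ φ, ∀ w ∈ φ, x ≠ y → x ≠ w → y ≠ w →
    dist w (bisectorPoint p d (x, y)) ≠ bisectorRadius p d (x, y)

/-- The other nuclei are strictly farther from `c`, and by local finiteness from all points near
`c`. So the facet contains short segments from `c` in all directions orthogonal to `y - x`, and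
these span its direction plane. -/
lemma finrank_vectorSpan_facet {φ : Set E3} (hφ : ∀ R : ℝ, (φ ∩ Metric.closedBall 0 R).Finite)
    {x y c : E3} (hxy : x ≠ y) (hc : dist x c = dist y c)
    (hfar : ∀ w ∈ φ, w ≠ x → w ≠ y → dist x c < dist w c) :
    Module.finrank ℝ (vectorSpan ℝ (facet φ x y)) = 2 ∨ x ∉ φ ∨ y ∉ φ := by
  by_cases hx : x ∈ φ
  swap
  · exact Or.inr (Or.inl hx)
  by_cases hy : y ∈ φ
  swap
  · exact Or.inr (Or.inr hy)
  left
  have hnear : ∀ᶠ s in nhds c, ∀ w ∈ φ, w ≠ x → w ≠ y → dist s x < dist s w := by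
    -- A nucleus `w` outside this ball has `dist w c > dist x c + 3`, so moving `c` by less than `1`
    -- cannot bring it closer than `x`. Only finitely many nuclei remain.
    have h1 : ∀ᶠ s in nhds c, ∀ w ∈ φ ∩ Metric.closedBall 0 (‖c‖ + dist x c + 3),
        w ≠ x → w ≠ y → dist s x < dist s w := by
      refine (hφ _).eventually_all.2 fun w hw => ?_
      by_cases hwx : w = x
      · exact Filter.Eventually.of_forall fun _ h => absurd hwx h
      by_cases hwy : w = y
      · exact Filter.Eventually.of_forall fun _ _ h => absurd hwy h
      have hlt := hfar w hw.1 hwx hwy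
      rw [dist_comm x, dist_comm w] at hlt
      have ho : IsOpen {s : E3 | dist s x < dist s w} :=
        isOpen_lt (by fun_prop) (by fun_prop)
      filter_upwards [ho.mem_nhds hlt] with s hs _ _
      exact hs
    filter_upwards [h1, Metric.ball_mem_nhds c one_pos] with s hs hsc w hw hwx hwy
    by_cases hwb : w ∈ Metric.closedBall 0 (‖c‖ + dist x c + 3)
    · exact hs w ⟨hw, hwb⟩ hwx hwy
    · rw [mem_closedBall_zero_iff, not_le] at hwb
      rw [Metric.mem_ball] at hsc
      have h2 : ‖w‖ ≤ ‖c‖ + dist w c := by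
        rw [dist_eq_norm]; exact norm_le_norm_add_norm_sub' w c
      have h3 := dist_triangle w s c
      have h4 := dist_triangle s c x
      rw [dist_comm w s] at h3
      rw [dist_comm c x] at h4
      linarith
  have hmem : ∀ n : E3, inner ℝ (y - x) n = 0 → ∀ᶠ ε in nhds (0 : ℝ), c + ε • n ∈ facet φ x y := by
    intro n hn
    have hlim : Filter.Tendsto (fun ε : ℝ => c + ε • n) (nhds 0) (nhds c) := by
      have : Continuous fun ε : ℝ => c + ε • n := by fun_prop
      simpa using this.tendsto 0
    filter_upwards [hlim.eventually hnear] with ε hε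
    have heq : dist (c + ε • n) x = dist (c + ε • n) y := by
      have h0 : inner ℝ ((x - c) + (y - c)) ((x - c) - (y - c)) = 0 := by
        rw [real_inner_add_sub_eq_zero_iff, ← dist_eq_norm, ← dist_eq_norm, hc]
      rw [dist_comm, dist_comm _ y, dist_eq_norm, dist_eq_norm, ← real_inner_add_sub_eq_zero_iff]
      have e1 : x - (c + ε • n) + (y - (c + ε • n)) = ((x - c) + (y - c)) - (2 * ε) • n := by
        module
      have e2 : x - (c + ε • n) - (y - (c + ε • n)) = (x - c) - (y - c) := by module
      have e3 : (x - c) - (y - c) = -(y - x) := by abel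
      rw [e1, e2, inner_sub_left, h0, e3, inner_smul_left, inner_neg_right, real_inner_comm, hn]
      simp
    refine ⟨fun w hw => ?_, fun w hw => ?_⟩
    · by_cases hwx : w = x
      · rw [hwx]
      by_cases hwy : w = y
      · rw [hwy, heq]
      exact (hε w hw hwx hwy).le
    · by_cases hwx : w = x
      · rw [hwx, heq]
      by_cases hwy : w = y
      · rw [hwy]
      exact heq ▸ (hε w hw hwx hwy).le
  have hspan : vectorSpan ℝ (facet φ x y) = (Submodule.span ℝ {y - x})ᗮ := by
    apply le_antisymm
    · rw [vectorSpan_def, Submodule.span_le]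
      rintro _ ⟨s, hs, t, ht, rfl⟩
      have hd : ∀ s ∈ facet φ x y, inner ℝ (y - x) ((2 : ℝ) • s) = inner ℝ (y - x) (x + y) := by
        intro s hs
        have heq : dist x s = dist y s := by
          rw [dist_comm x, dist_comm y]
          exact le_antisymm (hs.1 y hy) (hs.2 x hx)
        rw [dist_eq_norm, dist_eq_norm, ← real_inner_add_sub_eq_zero_iff] at heq
        have e1 : x - s + (y - s) = (x + y) - (2 : ℝ) • s := by module
        have e2 : x - s - (y - s) = -(y - x) := by abel
        rw [e1, e2, inner_neg_right, real_inner_comm, inner_sub_right] at heq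
        linarith
      have h1 := hd s hs
      have h2 := hd t ht
      rw [inner_smul_right] at h1 h2
      rw [SetLike.mem_coe, Submodule.mem_orthogonal_singleton_iff_inner_right]
      change inner ℝ (y - x) (s - t) = 0
      rw [inner_sub_right]
      linarith
    · intro n hn
      rw [Submodule.mem_orthogonal_singleton_iff_inner_right] at hn
      have h0 : c ∈ facet φ x y := by
        simpa using (hmem n hn).self_of_nhds
      obtain ⟨ε, hε, hε0⟩ := ((hmem n hn).filter_mono nhdsWithin_le_nhds |>.and
        (self_mem_nhdsWithin : {(0 : ℝ)}ᶜ ∈ nhdsWithin 0 {(0 : ℝ)}ᶜ)).exists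
      have h1 := vsub_mem_vectorSpan ℝ hε h0
      have h2 : n = ε⁻¹ • ((c + ε • n) -ᵥ c) := by
        rw [vsub_eq_sub, add_sub_cancel_left, smul_smul, inv_mul_cancel₀ hε0, one_smul]
      rw [h2]
      exact Submodule.smul_mem _ _ h1
  rw [hspan]
  have : Fact (Module.finrank ℝ E3 = 2 + 1) := ⟨by simp⟩
  exact Submodule.finrank_orthogonal_span_singleton (sub_ne_zero.2 hxy.symm)

variable {r : E3 → E3 → Prop} {p d : E3} {φ : Set E3}

/-- In general position the dimension condition is automatic: an empty open ball with no third
nucleus on its sphere makes all other nuclei strictly farther. -/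
lemma IsGeneric.onTwoFacet_iff (hφ : IsGeneric r p d φ) (x y : E3) (z : ℝ) :
    OnTwoFacet φ x y (linePoint p d z) ↔ x ∈ φ ∧ y ∈ φ ∧ x ≠ y ∧ z = bisectorAbscissa p d (x, y) ∧
      φ ∩ Metric.ball (bisectorPoint p d (x, y)) (bisectorRadius p d (x, y)) = ∅ := by
  constructor
  · rintro ⟨hx, hy, hxy, -, h⟩
    have heq : dist x (linePoint p d z) = dist y (linePoint p d z) := by
      rw [dist_comm x, dist_comm y]
      exact le_antisymm (h.1 y hy) (h.2 x hx)
    have hz := (dist_linePoint_eq_iff (hφ.inner_ne x hx y hy hxy) z).1 heq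
    refine ⟨hx, hy, hxy, hz, eq_empty_iff_forall_notMem.2 ?_⟩
    rintro w ⟨hw, hwb⟩
    have := h.1 w hw
    rw [hz] at this
    rw [Metric.mem_ball, bisectorRadius, dist_comm, dist_comm x] at hwb
    exact absurd this (not_le.2 hwb)
  · rintro ⟨hx, hy, hxy, rfl, h⟩
    have heq := (dist_linePoint_eq_iff (p := p) (hφ.inner_ne x hx y hy hxy) _).2 rfl
    have hle : ∀ w ∈ φ, dist x (bisectorPoint p d (x, y)) ≤ dist w (bisectorPoint p d (x, y)) := by
      intro w hw
      by_contra hlt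
      rw [not_le] at hlt
      exact (h ▸ notMem_empty w) ⟨hw, hlt⟩
    refine ⟨hx, hy, hxy, ?_, ?_, ?_⟩
    · have := finrank_vectorSpan_facet hφ.finite hxy heq fun w hw hwx hwy =>
        lt_of_le_of_ne (hle w hw)
          (hφ.sphere x hx y hy w hw hxy (Ne.symm hwx) (Ne.symm hwy)).symm
      tauto
    · intro w hw
      rw [dist_comm, dist_comm _ w]
      exact hle w hw
    · intro w hw
      rw [dist_comm, dist_comm _ w, ← heq]
      exact hle w hw

/-- All nuclei whose cells contain the crossing are at the same minimal distance from it, and the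
sphere of that radius carries only `x` and `y`. -/
lemma IsGeneric.pair_unique (hφ : IsGeneric r p d φ) {x y x' y' : E3} {z : ℝ}
    (h : OnTwoFacet φ x y (linePoint p d z)) (h' : OnTwoFacet φ x' y' (linePoint p d z)) :
    x' = x ∨ x' = y := by
  obtain ⟨hx, hy, hxy, hz, -⟩ := (hφ.onTwoFacet_iff x y z).1 h
  by_contra hne
  rw [not_or] at hne
  refine hφ.sphere x hx y hy x' h'.1 hxy (Ne.symm hne.1) (Ne.symm hne.2) ?_
  rw [bisectorRadius, bisectorPoint, ← hz]
  have h1 := h.2.2.2.2.1 x' h'.1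
  have h2 := h'.2.2.2.2.1 x hx
  rw [dist_comm x', dist_comm x]
  exact le_antisymm h2 h1

lemma OnTwoFacet.symm {x y z : E3} (h : OnTwoFacet φ x y z) : OnTwoFacet φ y x z := by
  obtain ⟨hx, hy, hxy, h1, h2⟩ := h
  have : facet φ y x = facet φ x y := inter_comm _ _
  exact ⟨hy, hx, hxy.symm, this ▸ h1, this ▸ h2⟩

lemma IsGeneric.existsUnique_pair (hr : IsPairOrder r) (hφ : IsGeneric r p d φ) {z : ℝ}
    (hz : z ∈ crossings φ p d) :
    ∃! q : E3 × E3, r q.1 q.2 ∧ OnTwoFacet φ q.1 q.2 (linePoint p d z) := by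
  have huniq : ∀ x y : E3, r x y → OnTwoFacet φ x y (linePoint p d z) →
      ∃! q : E3 × E3, r q.1 q.2 ∧ OnTwoFacet φ q.1 q.2 (linePoint p d z) := by
    intro x y hxy h
    refine ⟨(x, y), ⟨hxy, h⟩, ?_⟩
    rintro ⟨x', y'⟩ ⟨hr', h'⟩
    have h1 := hφ.pair_unique h h'
    have h2 := hφ.pair_unique h h'.symm
    have hne := h'.2.2.1
    simp only at hr' h1 h2 hne
    rcases h1 with rfl | rfl <;> rcases h2 with rfl | rfl
    · exact absurd rfl hne
    · rfl
    · exact absurd (hr.trans _ _ _ hxy hr') (hr.irrefl _)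
    · exact absurd rfl hne
  obtain ⟨x, y, h⟩ := hz
  rcases hφ.total x h.1 y h.2.1 h.2.2.1 with h1 | h1
  · exact huniq x y h1 h
  · exact huniq y x h1 h.symm

/-- The ordered pairs of points whose bisector meets the line at an abscissa in `B`, and which are
seen from there under an angle in `A`. -/
def anglePairs (r : E3 → E3 → Prop) (H : Set E3) (p d : E3) (B A : Set ℝ) : Set (E3 × E3) :=
  {q | inner ℝ (q.2 - q.1) d ≠ 0 ∧ r q.1 q.2 ∧ bisectorAbscissa p d q ∈ B ∧
    orientedAngle H q.1 (bisectorPoint p d q) q.2 ∈ A}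

/-- `bisectorAbscissa` maps the pairs bijectively onto the crossings with the prescribed marks; it
is injective because a crossing determines its ordered pair. By the same uniqueness the choice
inside `crossingAngle` is harmless. -/
lemma IsGeneric.encard_crossings (hr : IsPairOrder r) (hφ : IsGeneric r p d φ) (H : Set E3)
    (B A : Set ℝ) :
    {z ∈ crossings φ p d | z ∈ B ∧ crossingAngle r H φ p d z ∈ A}.encard =
      (emptyBallPairs φ (anglePairs r H p d B A) (bisectorPoint p d)
        (bisectorRadius p d)).encard := by
  set S := emptyBallPairs φ (anglePairs r H p d B A) (bisectorPoint p d) (bisectorRadius p d)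
  have hne : ∀ q : E3 × E3, r q.1 q.2 → q.1 ≠ q.2 := fun q h e => hr.irrefl _ (e ▸ h)
  have hS : ∀ q ∈ S, r q.1 q.2 ∧
      OnTwoFacet φ q.1 q.2 (linePoint p d (bisectorAbscissa p d q)) := by
    rintro ⟨x, y⟩ ⟨⟨h1, h2, h3, h4⟩, hx, hy, he⟩
    exact ⟨h2, (hφ.onTwoFacet_iff x y _).2 ⟨hx, hy, hne _ h2, rfl, he⟩⟩
  have hangle : ∀ q : E3 × E3, ∀ z, r q.1 q.2 → OnTwoFacet φ q.1 q.2 (linePoint p d z) →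
      crossingAngle r H φ p d z = orientedAngle H q.1 (linePoint p d z) q.2 := by
    intro q z h1 h2
    have hex : ∃ q : E3 × E3, r q.1 q.2 ∧ OnTwoFacet φ q.1 q.2 (linePoint p d z) := ⟨q, h1, h2⟩
    have heq : hex.choose = q :=
      (hφ.existsUnique_pair hr ⟨q.1, q.2, h2⟩).unique hex.choose_spec ⟨h1, h2⟩
    rw [crossingAngle, dif_pos hex, heq]
  have hinj : InjOn (bisectorAbscissa p d) S := by
    intro q hq q' hq' he
    have h1 := hS q hq
    have h2 := hS q' hq'
    rw [← he] at h2
    exact (hφ.existsUnique_pair hr ⟨q.1, q.2, h1.2⟩).unique h1 h2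
  rw [← hinj.encard_image]
  congr 1
  ext z
  constructor
  · rintro ⟨hz, hB, hA⟩
    obtain ⟨⟨x, y⟩, ⟨h1, h2⟩, -⟩ := hφ.existsUnique_pair hr hz
    obtain ⟨hx, hy, hxy, hz', he⟩ := (hφ.onTwoFacet_iff x y z).1 h2
    refine ⟨(x, y), ⟨⟨hφ.inner_ne x hx y hy hxy, h1, hz' ▸ hB, ?_⟩, hx, hy, he⟩, hz'.symm⟩
    rw [hangle (x, y) z h1 h2] at hA
    rw [bisectorPoint, ← hz']
    exact hA
  · rintro ⟨q, hq, rfl⟩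
    have h1 := hS q hq
    refine ⟨⟨q.1, q.2, h1.2⟩, hq.1.2.2.1, ?_⟩
    rw [hangle q _ h1.1 h1.2]
    exact hq.1.2.2.2

end Geometry

/-! ### General position and the mean number of crossings as an integral -/

section MeanCrossings

lemma measurable_cross {α : Type*} [MeasurableSpace α] {f g : α → E3} (hf : Measurable f)
    (hg : Measurable g) : Measurable fun a => cross (f a) (g a) := by
  have hi : ∀ {h : α → E3}, Measurable h → ∀ i, Measurable fun a => h a i := fun hh i =>
    (PiLp.continuous_apply 2 _ i).measurable.comp hh
  have : Measurable fun a => crossProduct (WithLp.ofLp (f a)) (WithLp.ofLp (g a)) := by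
    refine measurable_pi_iff.2 fun i => ?_
    fin_cases i
    · simp only [cross_apply]
      exact ((hi hf 1).mul (hi hg 2)).sub ((hi hf 2).mul (hi hg 1))
    · simp only [cross_apply]
      exact ((hi hf 2).mul (hi hg 0)).sub ((hi hf 0).mul (hi hg 2))
    · simp only [cross_apply]
      exact ((hi hf 0).mul (hi hg 1)).sub ((hi hf 1).mul (hi hg 0))
  exact (PiLp.continuous_toLp 2 _).measurable.comp this

lemma measurable_angle {α : Type*} [MeasurableSpace α] {f g : α → E3} (hf : Measurable f)
    (hg : Measurable g) : Measurable fun a => InnerProductGeometry.angle (f a) (g a) := by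
  unfold InnerProductGeometry.angle
  exact Real.measurable_arccos.comp ((hf.inner hg).div (hf.norm.mul hg.norm))

lemma measurable_orientedAngle {H : Set E3} (hH : MeasurableSet H) {α : Type*} [MeasurableSpace α]
    {f g h : α → E3} (hf : Measurable f) (hg : Measurable g) (hh : Measurable h) :
    Measurable fun a => orientedAngle H (f a) (g a) (h a) := by
  have ha := measurable_angle (hf.sub hg) (hh.sub hg)
  have hc := measurable_cross (hf.sub hg) (hh.sub hg)
  simp only [Pi.sub_apply] at ha hc
  have hs : MeasurableSet {a | InnerProductGeometry.angle (f a - g a) (h a - g a) = 0} :=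
    measurableSet_eq_fun ha measurable_const
  have hs' : MeasurableSet {a | cross (f a - g a) (h a - g a) ∈ H} := measurableSet_preimage hc hH
  unfold orientedAngle
  exact Measurable.ite hs measurable_const (Measurable.ite hs' ha (measurable_const.sub ha))

lemma IsPairOrder.iff_sub {r : E3 → E3 → Prop} (hr : IsPairOrder r) (x y : E3) :
    r x y ↔ r 0 (y - x) := by
  have := hr.translate 0 (y - x) x
  simpa using this

lemma IsPairOrder.measurableSet {r : E3 → E3 → Prop} (hr : IsPairOrder r) :
    MeasurableSet {q : E3 × E3 | r q.1 q.2} := by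
  have : {q : E3 × E3 | r q.1 q.2} = (fun q : E3 × E3 => q.2 - q.1) ⁻¹' {v | r 0 v} := by
    ext q
    exact hr.iff_sub q.1 q.2
  rw [this]
  exact (measurable_snd.sub measurable_fst) hr.measurable

lemma measurableSet_anglePairs {r : E3 → E3 → Prop} (hr : IsPairOrder r) {H : Set E3}
    (hH : IsPlaneOrientation H) (p d : E3) {B A : Set ℝ} (hB : MeasurableSet B)
    (hA : MeasurableSet A) : MeasurableSet (anglePairs r H p d B A) := by
  refine MeasurableSet.inter ?_ (hr.measurableSet.inter
    ((measurable_bisectorAbscissa p d hB).inter ?_))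
  · exact (measurableSet_eq_fun (by fun_prop) measurable_const).compl
  · exact measurable_orientedAngle hH.measurable measurable_fst (measurable_bisectorPoint p d)
      measurable_snd hA

lemma volume_inner_eq_zero {d : E3} (hd : d ≠ 0) : volume {v : E3 | inner ℝ v d = 0} = 0 := by
  have h := Measure.addHaar_submodule (volume : Measure E3) (Submodule.span ℝ {d})ᗮ (by
    intro h
    have h1 : d ∈ (Submodule.span ℝ {d})ᗮ := h ▸ Submodule.mem_top
    rw [Submodule.mem_orthogonal_singleton_iff_inner_right] at h1
    exact hd (inner_self_eq_zero.1 h1))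
  convert! h using 2
  ext v
  rw [SetLike.mem_coe, Submodule.mem_orthogonal_singleton_iff_inner_left]
  rfl

/-- Each slice is a translate of a null set. -/
lemma volume_prod_null_of_sub {N : Set E3} (hN : volume N = 0) :
    volume {q : E3 × E3 | q.2 - q.1 ∈ N} = 0 := by
  refine measure_mono_null (t := {q : E3 × E3 | q.2 - q.1 ∈ toMeasurable volume N})
    (fun q hq => subset_toMeasurable _ _ hq) ?_
  have hm : MeasurableSet {q : E3 × E3 | q.2 - q.1 ∈ toMeasurable volume N} :=
    (measurable_snd.sub measurable_fst) (measurableSet_toMeasurable _ _)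
  rw [Measure.volume_eq_prod, Measure.measure_prod_null hm]
  refine Filter.Eventually.of_forall fun x => ?_
  have : Prod.mk x ⁻¹' {q : E3 × E3 | q.2 - q.1 ∈ toMeasurable volume N} =
      (fun y => y - x) ⁻¹' toMeasurable volume N := rfl
  dsimp only [Pi.zero_apply]
  rw [this]
  simp only [sub_eq_add_neg, measure_preimage_add_right, measure_toMeasurable, hN]

variable {Ω : Type*} [MeasurableSpace Ω] {P : Measure Ω} {Φ : Ω → Set E3} {lam : ℝ≥0}

lemma volume_bisectorSphere (p d : E3) :
    volume {t : (E3 × E3) × E3 | dist t.2 (bisectorPoint p d t.1) = bisectorRadius p d t.1} = 0 := by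
  have hm : MeasurableSet {t : (E3 × E3) × E3 | dist t.2 (bisectorPoint p d t.1) =
      bisectorRadius p d t.1} :=
    measurableSet_eq_fun (measurable_snd.dist ((measurable_bisectorPoint p d).comp
      measurable_fst)) ((measurable_bisectorRadius p d).comp measurable_fst)
  rw [Measure.volume_eq_prod, Measure.measure_prod_null hm]
  refine Filter.Eventually.of_forall fun q => ?_
  have : Prod.mk q ⁻¹' {t : (E3 × E3) × E3 | dist t.2 (bisectorPoint p d t.1) =
      bisectorRadius p d t.1} = Metric.sphere (bisectorPoint p d q) (bisectorRadius p d q) := by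
    ext w
    rw [Metric.mem_sphere]
    exact Iff.rfl
  dsimp only [Pi.zero_apply]
  rw [this]
  exact Measure.addHaar_sphere volume _ _

lemma IsPoissonProcess.ae_isGeneric (hΦ : IsPoissonProcess P Φ lam) [IsProbabilityMeasure P]
    (hlf : ∀ ω, ∀ R : ℝ, (Φ ω ∩ Metric.closedBall 0 R).Finite)
    {r : E3 → E3 → Prop} (hr : IsPairOrder r) (p : E3) {d : E3} (hd : d ≠ 0) :
    ∀ᵐ ω ∂P, IsGeneric r p d (Φ ω) := by
  have h0 : volume {v : E3 | ¬ (r 0 v ∨ r v 0)} = 0 := ae_iff.1 hr.ae_total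
  have h1 := hΦ.ae_forall_pair hlf (volume_prod_null_of_sub (volume_inner_eq_zero hd))
  have h2 := hΦ.ae_forall_pair hlf (volume_prod_null_of_sub h0)
  have h3 := hΦ.ae_forall_triple hlf (volume_bisectorSphere p d)
  filter_upwards [h1, h2, h3] with ω h1 h2 h3
  refine ⟨hlf ω, ?_, ?_, ?_⟩
  · intro x hx y hy hxy h
    exact h1 x hx y hy hxy h
  · intro x hx y hy hxy
    have h := h2 x hx y hy hxy
    simp only [not_not] at h
    rw [hr.iff_sub x y, hr.iff_sub y x]
    refine h.imp id fun h => ?_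
    rw [hr.iff_sub] at h
    simpa using h
  · intro x hx y hy w hw hxy hxw hyw h
    exact h3 x hx y hy w hw hxy hxw hyw h

/-- Local finiteness is assumed only almost surely, while the counting arguments use it for every
`ω`. Emptying the configuration on the exceptional event changes no law; that event is measurable,
since counts in balls of integer radius detect it. -/
lemma IsPoissonProcess.exists_locallyFinite (hΦ : IsPoissonProcess P Φ lam) :
    ∃ Ψ : Ω → Set E3, IsPoissonProcess P Ψ lam ∧
      (∀ ω, ∀ R : ℝ, (Ψ ω ∩ Metric.closedBall 0 R).Finite) ∧ ∀ᵐ ω ∂P, Φ ω = Ψ ω := by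
  classical
  set G : Set Ω := {ω | ∀ R : ℝ, (Φ ω ∩ Metric.closedBall 0 R).Finite} with hG
  have hGm : MeasurableSet G := by
    have : G = ⋂ K : ℕ, {ω | (Φ ω ∩ Metric.closedBall 0 K).encard ≠ ⊤} := by
      ext ω
      simp only [hG, mem_ofPred_eq, mem_iInter, ne_eq, encard_eq_top_iff, not_infinite]
      refine ⟨fun h K => h K, fun h R => ?_⟩
      obtain ⟨K, hK⟩ := exists_nat_ge R
      exact (h K).subset (inter_subset_inter_right _ (Metric.closedBall_subset_closedBall hK))
    rw [this]
    refine MeasurableSet.iInter fun K => ?_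
    exact (hΦ.measurable_count _ Metric.isClosed_closedBall.measurableSet)
      (measurableSet_singleton ⊤).compl
  set Ψ : Ω → Set E3 := fun ω => if ω ∈ G then Φ ω else ∅ with hΨ
  have hae : ∀ᵐ ω ∂P, Φ ω = Ψ ω := by
    filter_upwards [hΦ.locallyFinite] with ω hω
    have : ω ∈ G := hω
    simp [hΨ, this]
  have hcae : ∀ B : Set E3, (fun ω => (Φ ω ∩ B).encard) =ᵐ[P] fun ω => (Ψ ω ∩ B).encard :=
    fun B => hae.mono fun ω h => by simp only [h]
  have hlf : ∀ ω, ∀ R : ℝ, (Ψ ω ∩ Metric.closedBall 0 R).Finite := by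
    intro ω R
    by_cases h : ω ∈ G
    · simpa [hΨ, h] using h R
    · simp [hΨ, h]
  refine ⟨Ψ, ⟨ae_of_all _ hlf, fun B hB => ?_, fun B hB hv k => ?_, fun n B hB hd => ?_⟩, hlf, hae⟩
  · have : (fun ω => (Ψ ω ∩ B).encard) = fun ω => if ω ∈ G then (Φ ω ∩ B).encard else 0 := by
      ext ω
      by_cases h : ω ∈ G <;> simp [hΨ, h]
    rw [this]
    exact Measurable.ite hGm (hΦ.measurable_count B hB) measurable_const
  · rw [← hΦ.poisson_count B hB hv k]
    refine measure_congr ?_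
    filter_upwards [hcae B] with ω hω
    change ((Ψ ω ∩ B).encard = k) = ((Φ ω ∩ B).encard = k)
    rw [hω]
  · exact (hΦ.indep_count n B hB hd).congr fun i => hcae (B i)

lemma IsPoissonProcess.meanCrossings_eq (hΦ : IsPoissonProcess P Φ lam) [IsProbabilityMeasure P]
    {r : E3 → E3 → Prop} (hr : IsPairOrder r) {H : Set E3} (hH : IsPlaneOrientation H)
    (p : E3) {d : E3} (hd : d ≠ 0) {B A : Set ℝ} (hB : MeasurableSet B) (hA : MeasurableSet A) :
    meanCrossings P Φ r H p d B A = lam ^ 2 * ∫⁻ q in anglePairs r H p d B A,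
      voidProb lam (Metric.ball (bisectorPoint p d q) (bisectorRadius p d q)) := by
  obtain ⟨Ψ, hΨ, hlf, hae⟩ := hΦ.exists_locallyFinite
  have hgen := hΨ.ae_isGeneric hlf hr p hd
  rw [← hΨ.lintegral_emptyBallPairs hlf (measurableSet_anglePairs hr hH p d hB hA)
    (fun q hq e => hr.irrefl _ (e ▸ hq.2.1)) (fun q hq => continuousAt_bisectorPoint p hq.1)
    (fun q hq => continuousAt_bisectorRadius p hq.1) (fun q _ => rfl)
    (fun q hq => dist_bisectorPoint_snd hq.1)
    (hgen.mono fun ω h q hq h1 h2 w hw hw1 hw2 => h.sphere q.1 h1 q.2 h2 w hw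
      (fun e => hr.irrefl _ (e ▸ hq.2.1)) (Ne.symm hw1) (Ne.symm hw2))]
  refine lintegral_congr_ae ?_
  filter_upwards [hae, hgen] with ω h1 h2
  rw [h1, h2.encard_crossings hr H B A]

lemma IsPoissonProcess.ae_existsUnique_pair (hΦ : IsPoissonProcess P Φ lam)
    [IsProbabilityMeasure P]
    {r : E3 → E3 → Prop} (hr : IsPairOrder r) (p : E3) {d : E3} (hd : d ≠ 0) :
    ∀ᵐ ω ∂P, ∀ z ∈ crossings (Φ ω) p d, ∃! q : E3 × E3,
      r q.1 q.2 ∧ OnTwoFacet (Φ ω) q.1 q.2 (linePoint p d z) := by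
  obtain ⟨Ψ, hΨ, hlf, hae⟩ := hΦ.exists_locallyFinite
  filter_upwards [hae, hΨ.ae_isGeneric hlf hr p hd] with ω h1 h2 z hz
  rw [h1] at hz ⊢
  exact h2.existsUnique_pair hr hz

lemma crossingIntensity_eq (P : Measure Ω) (Φ : Ω → Set E3) (r : E3 → E3 → Prop) (H : Set E3)
    (p d : E3) : crossingIntensity P Φ p d = meanCrossings P Φ r H p d (Icc 0 1) univ := by
  simp only [crossingIntensity, meanCrossings, mem_univ, and_true]
  rfl

end MeanCrossings

/-! ### Coordinates for pairs, planes and directions -/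

section ChangeOfVariables

lemma lintegral_eq_mul_lintegral_comp_mul_left {a : ℝ} (ha : a ≠ 0) {f : ℝ → ℝ≥0∞}
    (hf : Measurable f) : ∫⁻ x, f x = ENNReal.ofReal |a| * ∫⁻ x, f (a * x) := by
  conv_lhs => rw [← Real.smul_map_volume_mul_left ha]
  rw [lintegral_smul_measure, lintegral_map hf (measurable_const_mul a), smul_eq_mul]

/-- Integration over pairs of points in terms of their midpoint and their difference. -/
lemma lintegral_pairs (p : E3) {F : E3 × E3 → ℝ≥0∞} (hF : Measurable F) :
    ∫⁻ q, F q = ∫⁻ v, ∫⁻ s, F (p + s - (2⁻¹ : ℝ) • v, p + s + (2⁻¹ : ℝ) • v) := by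
  rw [Measure.volume_eq_prod, lintegral_prod _ hF.aemeasurable]
  have h1 : ∀ x, ∫⁻ y, F (x, y) = ∫⁻ v, F (x, v + x) := fun x =>
    (lintegral_add_right_eq_self (fun y => F (x, y)) x).symm
  simp only [h1]
  rw [lintegral_lintegral_swap (by
    refine Measurable.aemeasurable ?_
    exact hF.comp (measurable_fst.prodMk (measurable_snd.add measurable_fst)))]
  refine lintegral_congr fun v => ?_
  rw [← lintegral_add_right_eq_self (fun x => F (x, v + x)) (p - (2⁻¹ : ℝ) • v)]
  refine lintegral_congr fun s => ?_
  congr 2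
  · abel
  · module

/-- Integration in an orthonormal coordinate system. -/
lemma lintegral_orthonormalBasis (b : OrthonormalBasis (Fin 3) ℝ E3) {F : E3 → ℝ≥0∞}
    (hF : Measurable F) :
    ∫⁻ x, F x = ∫⁻ t : ℝ, ∫⁻ w : ℝ × ℝ, F (t • b 0 + w.1 • b 1 + w.2 • b 2) := by
  have h1 := b.measurePreserving_repr_symm.comp (PiLp.volume_preserving_toLp (Fin 3))
  have h2 := h1.comp (volume_preserving_piFinSuccAbove (fun _ : Fin 3 => ℝ) 0).symm
  have h3 : MeasurePreserving (fun w : ℝ × (ℝ × ℝ) =>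
      ((w.1, (MeasurableEquiv.finTwoArrow.symm w.2 : Fin 2 → ℝ)) : ℝ × (Fin 2 → ℝ))) :=
    (MeasurePreserving.id volume).prod (volume_preserving_finTwoArrow ℝ).symm
  have h4 := h2.comp h3
  rw [← h4.lintegral_comp hF, Measure.volume_eq_prod, lintegral_prod]
  · refine lintegral_congr fun t => lintegral_congr fun w => ?_
    congr 1
    simp only [Function.comp_apply]
    rw [← b.sum_repr_symm]
    simp [Fin.sum_univ_three, add_assoc]
  · exact (hF.comp h4.measurable).aemeasurable

lemma lintegral_radial {G : ℝ → ℝ≥0∞} (hG : Measurable G) :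
    ∫⁻ w : ℝ × ℝ, G (√(w.1 ^ 2 + w.2 ^ 2)) =
      ENNReal.ofReal (2 * Real.pi) * ∫⁻ s in Ioi (0 : ℝ), ENNReal.ofReal s * G s := by
  rw [← lintegral_comp_polarCoord_symm, polarCoord_target, Measure.volume_eq_prod]
  have h : ∀ w ∈ Ioi (0 : ℝ) ×ˢ Ioo (-Real.pi) Real.pi,
      ENNReal.ofReal w.1 • G (√((polarCoord.symm w).1 ^ 2 + (polarCoord.symm w).2 ^ 2)) =
        ENNReal.ofReal w.1 * G w.1 := by
    rintro ⟨s, φ⟩ ⟨hs, -⟩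
    simp only [polarCoord_symm_apply, smul_eq_mul]
    congr 2
    rw [mul_pow, mul_pow, ← mul_add, Real.cos_sq_add_sin_sq, mul_one,
      Real.sqrt_sq (le_of_lt hs)]
  rw [setLIntegral_congr_fun (measurableSet_Ioi.prod measurableSet_Ioo) h,
    ← Measure.prod_restrict, lintegral_prod]
  · simp only [lintegral_const, Measure.restrict_apply_univ, Real.volume_Ioo]
    rw [lintegral_mul_const _ (by fun_prop), mul_comm]
    congr 2
    ring
  · fun_prop

/-- Polar coordinates in dimension three: `κ` depends on the direction only, so the integral is a
product. -/
lemma lintegral_direction_mul_radial {κ : E3 → ℝ≥0∞} (hκ : Measurable κ)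
    (hhom : ∀ (c : ℝ) (v : E3), 0 < c → κ (c • v) = κ v) {J : ℝ → ℝ≥0∞} (hJ : Measurable J) :
    ∫⁻ v, κ v * J ‖v‖ = (∫⁻ u : Metric.sphere (0 : E3) 1, κ u ∂(volume : Measure E3).toSphere) *
      ∫⁻ ρ in Ioi (0 : ℝ), ENNReal.ofReal (ρ ^ 2) * J ρ := by
  have hm : Measurable fun v : E3 => κ v * J ‖v‖ := hκ.mul (hJ.comp measurable_norm)
  have h0 : ∫⁻ v, κ v * J ‖v‖ = ∫⁻ v in ({0}ᶜ : Set E3), κ v * J ‖v‖ := by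
    rw [restrict_compl_singleton]
  rw [h0, ← lintegral_subtype_comap (measurableSet_singleton (0 : E3)).compl]
  have hmp := (volume : Measure E3).measurePreserving_homeomorphUnitSphereProd
  have e : ∀ v : ({0}ᶜ : Set E3), κ v * J ‖(v : E3)‖ =
      (fun w : Metric.sphere (0 : E3) 1 × Ioi (0 : ℝ) => κ w.1 * J w.2)
        (homeomorphUnitSphereProd E3 v) := by
    intro v
    have hv : 0 < ‖(v : E3)‖ := norm_pos_iff.2 v.2
    simp only [homeomorphUnitSphereProd_apply_fst_coe, homeomorphUnitSphereProd_apply_snd_coe]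
    rw [hhom _ _ (inv_pos.2 hv)]
  simp only [e]
  rw [hmp.lintegral_comp (f := fun w : Metric.sphere (0 : E3) 1 × Ioi (0 : ℝ) => κ w.1 * J w.2)
    (by fun_prop), lintegral_prod_mul (f := fun u : Metric.sphere (0 : E3) 1 => κ u)
    (g := fun ρ : Ioi (0 : ℝ) => J ρ) (by fun_prop) (by fun_prop)]
  congr 1
  rw [Measure.volumeIoiPow, lintegral_withDensity_eq_lintegral_mul _ (by fun_prop) (by fun_prop)]
  simp only [Pi.mul_apply]
  rw [lintegral_subtype_comap measurableSet_Ioi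
    (fun ρ : ℝ => ENNReal.ofReal (ρ ^ (Module.finrank ℝ E3 - 1)) * J ρ)]
  simp

end ChangeOfVariables

/-! ### The angle seen from a crossing and its orientation -/

section OrientedAngle

/-- The angle under which the endpoints of a segment of length `ρ` are seen from a point of the
bisector plane at distance `s` from the midpoint. -/
def viewAngle (ρ s : ℝ) : ℝ := Real.arccos ((s ^ 2 - (ρ / 2) ^ 2) / (s ^ 2 + (ρ / 2) ^ 2))

/-- The number of the two oriented angles with the unoriented angle `t` that lie in `A`. -/
def angleWeight (A : Set ℝ) (t : ℝ) : ℝ≥0∞ :=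
  A.indicator 1 t + A.indicator 1 (2 * Real.pi - t)

lemma measurable_viewAngle : Measurable fun q : ℝ × ℝ => viewAngle q.1 q.2 := by
  unfold viewAngle
  exact Real.measurable_arccos.comp (by fun_prop)

lemma measurable_angleWeight {A : Set ℝ} (hA : MeasurableSet A) : Measurable (angleWeight A) := by
  unfold angleWeight
  have h : Measurable (A.indicator (1 : ℝ → ℝ≥0∞)) := measurable_one.indicator hA
  exact h.add (h.comp (by fun_prop))

lemma norm_sub_half_smul {v n : E3} (h : inner ℝ v n = 0) :
    ‖n - (2⁻¹ : ℝ) • v‖ = √(‖n‖ ^ 2 + (‖v‖ / 2) ^ 2) := by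
  rw [← Real.sqrt_sq (norm_nonneg (n - (2⁻¹ : ℝ) • v)), norm_sub_sq_real, inner_smul_right,
    real_inner_comm, h, norm_smul]
  congr 1
  norm_num
  ring

lemma norm_add_half_smul {v n : E3} (h : inner ℝ v n = 0) :
    ‖n + (2⁻¹ : ℝ) • v‖ = √(‖n‖ ^ 2 + (‖v‖ / 2) ^ 2) := by
  have := norm_sub_half_smul (v := -v) (n := n) (by rw [inner_neg_left, h, neg_zero])
  rwa [smul_neg, sub_neg_eq_add, norm_neg] at this

lemma angle_eq_viewAngle {v n : E3} (h : inner ℝ v n = 0) :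
    InnerProductGeometry.angle (n - (2⁻¹ : ℝ) • v) (n + (2⁻¹ : ℝ) • v) = viewAngle ‖v‖ ‖n‖ := by
  rw [InnerProductGeometry.angle, viewAngle, norm_sub_half_smul h, norm_add_half_smul h,
    Real.mul_self_sqrt (by positivity)]
  congr 2
  have h' : inner ℝ n v = 0 := by rw [real_inner_comm, h]
  rw [inner_add_right, inner_sub_left, inner_sub_left, inner_smul_left, inner_smul_right,
    inner_smul_left, inner_smul_right, h, h', real_inner_self_eq_norm_sq,
    real_inner_self_eq_norm_sq]
  simp
  ring

/-- Rules out the default branch of `orientedAngle`. -/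
lemma viewAngle_ne_zero {ρ s : ℝ} (hρ : ρ ≠ 0) : viewAngle ρ s ≠ 0 := by
  have hpos : 0 < s ^ 2 + (ρ / 2) ^ 2 := by positivity
  have h2 : 0 < (ρ / 2) ^ 2 := by positivity
  rw [viewAngle, Ne, Real.arccos_eq_zero, not_le, div_lt_one hpos]
  linarith

lemma cross_sub_add (v n : E3) :
    cross (n - (2⁻¹ : ℝ) • v) (n + (2⁻¹ : ℝ) • v) = cross n v := by
  unfold cross
  congr 1
  ext i
  fin_cases i <;> simp [cross_apply] <;> ring

lemma cross_neg_left (v n : E3) : cross (-n) v = -cross n v := by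
  unfold cross
  ext i
  fin_cases i <;> simp [cross_apply]

lemma cross_ne_zero {v n : E3} (hv : v ≠ 0) (hn : n ≠ 0) (h : inner ℝ v n = 0) :
    cross n v ≠ 0 := by
  intro h0
  have h1 : crossProduct (WithLp.ofLp n) (WithLp.ofLp v) = 0 := by
    simpa [cross] using h0
  have h2 := cross_dot_cross (WithLp.ofLp n) (WithLp.ofLp v) (WithLp.ofLp n) (WithLp.ofLp v)
  rw [h1, zero_dotProduct] at h2
  have e : ∀ a b : E3, (WithLp.ofLp a) ⬝ᵥ (WithLp.ofLp b) = inner ℝ b a := by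
    intro a b
    rw [EuclideanSpace.inner_eq_star_dotProduct]
    simp
  simp only [e] at h2
  rw [real_inner_comm v n, h, real_inner_self_eq_norm_sq, real_inner_self_eq_norm_sq] at h2
  have h3 : ‖n‖ ^ 2 * ‖v‖ ^ 2 = 0 := by linarith
  rcases mul_eq_zero.1 h3 with h4 | h4
  · exact hn (by simpa using h4)
  · exact hv (by simpa using h4)

/-- The reflection `n ↦ -n` keeps the unoriented angle and reverses the normal `cross n v`. Exactly
one of the two normals is in `H`, so the oriented angles are `t` and `2π - t` in some order,
whatever the convention. -/
lemma IsPlaneOrientation.indicator_add {H : Set E3} (hH : IsPlaneOrientation H) (A : Set ℝ)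
    {v n : E3} (hv : v ≠ 0) (hn : n ≠ 0) (h : inner ℝ v n = 0) :
    A.indicator (1 : ℝ → ℝ≥0∞) (orientedAngle H (n - (2⁻¹ : ℝ) • v) 0 (n + (2⁻¹ : ℝ) • v)) +
      A.indicator (1 : ℝ → ℝ≥0∞) (orientedAngle H (-n - (2⁻¹ : ℝ) • v) 0 (-n + (2⁻¹ : ℝ) • v)) =
      angleWeight A (viewAngle ‖v‖ ‖n‖) := by
  have h' : inner ℝ v (-n) = 0 := by rw [inner_neg_right, h, neg_zero]
  have h0 : viewAngle ‖v‖ ‖n‖ ≠ 0 := viewAngle_ne_zero (norm_ne_zero_iff.2 hv)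
  have hone := hH.one_side _ (cross_ne_zero hv hn h)
  have key : ∀ m : E3, inner ℝ v m = 0 → ‖m‖ = ‖n‖ →
      (cross m v ∈ H → orientedAngle H (m - (2⁻¹ : ℝ) • v) 0 (m + (2⁻¹ : ℝ) • v) =
        viewAngle ‖v‖ ‖n‖) ∧
      (cross m v ∉ H → orientedAngle H (m - (2⁻¹ : ℝ) • v) 0 (m + (2⁻¹ : ℝ) • v) =
        2 * Real.pi - viewAngle ‖v‖ ‖n‖) := by
    intro m hm hmn
    have ha := angle_eq_viewAngle hm
    rw [hmn] at ha
    have hc := cross_sub_add v m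
    rw [← hc, ← ha]
    rw [← ha] at h0
    constructor
    · intro h1
      rw [orientedAngle, sub_zero, sub_zero, if_neg h0, if_pos h1]
    · intro h1
      rw [orientedAngle, sub_zero, sub_zero, if_neg h0, if_neg h1]
  have k1 := key n h rfl
  have k2 := key (-n) h' (norm_neg n)
  rw [cross_neg_left] at k2
  unfold angleWeight
  by_cases hc : cross n v ∈ H
  · rw [k1.1 hc, k2.2 (hone.1 hc)]
  · rw [k1.2 hc, k2.1 (by tauto), add_comm]

end OrientedAngle

/-! ### Integration over midpoints for a fixed difference of the nuclei -/

section Slices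

/-- The void probability of a ball as a function of its radius. -/
def ballVoidProb (lam : ℝ≥0) (ρ : ℝ) : ℝ≥0∞ := voidProb lam (Metric.ball (0 : E3) ρ)

lemma voidProb_ball (lam : ℝ≥0) (c : E3) (ρ : ℝ) :
    voidProb lam (Metric.ball c ρ) = ballVoidProb lam ρ := by
  rw [ballVoidProb, voidProb, voidProb, Measure.addHaar_ball_center]

lemma measurable_ballVoidProb (lam : ℝ≥0) : Measurable (ballVoidProb lam) := by
  refine Antitone.measurable fun ρ σ h => ?_
  refine ENNReal.ofReal_le_ofReal (Real.exp_le_exp.2 (neg_le_neg ?_))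
  gcongr
  exact measure_ball_lt_top.ne

/-- The weight of the midpoints at distance `s` from the line, for nuclei at distance `ρ`. -/
def sliceWeight (lam : ℝ≥0) (A : Set ℝ) (ρ s : ℝ) : ℝ≥0∞ :=
  angleWeight A (viewAngle ρ s) * ballVoidProb lam (√(s ^ 2 + (ρ / 2) ^ 2))

lemma measurable_sliceWeight (lam : ℝ≥0) {A : Set ℝ} (hA : MeasurableSet A) :
    Measurable fun q : ℝ × ℝ => sliceWeight lam A q.1 q.2 := by
  unfold sliceWeight
  exact ((measurable_angleWeight hA).comp measurable_viewAngle).mul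
    ((measurable_ballVoidProb lam).comp (by fun_prop))

/-- The integral of `sliceWeight` over the midpoints in a plane. -/
def sliceIntegral (lam : ℝ≥0) (A : Set ℝ) (ρ : ℝ) : ℝ≥0∞ :=
  ENNReal.ofReal (2 * Real.pi) * ∫⁻ s in Ioi (0 : ℝ), ENNReal.ofReal s * sliceWeight lam A ρ s

lemma measurable_sliceIntegral (lam : ℝ≥0) {A : Set ℝ} (hA : MeasurableSet A) :
    Measurable (sliceIntegral lam A) := by
  unfold sliceIntegral
  refine Measurable.const_mul ?_ _
  exact Measurable.lintegral_prod_right'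
    (f := fun q : ℝ × ℝ => ENNReal.ofReal q.2 * sliceWeight lam A q.1 q.2)
    ((by fun_prop : Measurable fun q : ℝ × ℝ => ENNReal.ofReal q.2).mul
      (measurable_sliceWeight lam hA))

/-- The weight of a pair of nuclei with difference `v` and with midpoint `n` relative to the point
of the line in the bisector plane. -/
def pairWeight (lam : ℝ≥0) (H : Set E3) (A : Set ℝ) (v n : E3) : ℝ≥0∞ :=
  A.indicator 1 (orientedAngle H (n - (2⁻¹ : ℝ) • v) 0 (n + (2⁻¹ : ℝ) • v)) *
    ballVoidProb lam ‖n - (2⁻¹ : ℝ) • v‖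

lemma measurable_pairWeight (lam : ℝ≥0) {H : Set E3} (hH : MeasurableSet H) {A : Set ℝ}
    (hA : MeasurableSet A) {α : Type*} [MeasurableSpace α] {f g : α → E3} (hf : Measurable f)
    (hg : Measurable g) : Measurable fun a => pairWeight lam H A (f a) (g a) := by
  unfold pairWeight
  have hf' : Measurable fun a => (2⁻¹ : ℝ) • f a := hf.const_smul (2⁻¹ : ℝ)
  have h1 : Measurable fun a => orientedAngle H (g a - (2⁻¹ : ℝ) • f a) 0 (g a + (2⁻¹ : ℝ) • f a) :=
    measurable_orientedAngle hH (hg.sub hf') measurable_const (hg.add hf')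
  have h2 : Measurable fun a => ‖g a - (2⁻¹ : ℝ) • f a‖ := (hg.sub hf').norm
  exact ((measurable_one.indicator hA).comp h1).mul ((measurable_ballVoidProb lam).comp h2)

lemma pairWeight_add_neg (lam : ℝ≥0) {H : Set E3} (hH : IsPlaneOrientation H) (A : Set ℝ)
    {v n : E3} (hv : v ≠ 0) (hn : n ≠ 0) (h : inner ℝ v n = 0) :
    pairWeight lam H A v n + pairWeight lam H A v (-n) = sliceWeight lam A ‖v‖ ‖n‖ := by
  have h' : inner ℝ v (-n) = 0 := by rw [inner_neg_right, h, neg_zero]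
  rw [pairWeight, pairWeight, norm_sub_half_smul h, norm_sub_half_smul h', norm_neg, ← add_mul,
    hH.indicator_add A hv hn h, sliceWeight]

lemma exists_orthonormalBasis {v : E3} (hv : v ≠ 0) :
    ∃ b : OrthonormalBasis (Fin 3) ℝ E3, b 0 = ‖v‖⁻¹ • v := by
  have h1 : ‖‖v‖⁻¹ • v‖ = 1 := by
    rw [norm_smul, norm_inv, norm_norm, inv_mul_cancel₀ (norm_ne_zero_iff.2 hv)]
  obtain ⟨b, hb⟩ := Orthonormal.exists_orthonormalBasis_extension_of_card_eq (𝕜 := ℝ) (E := E3)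
    (ι := Fin 3) (by simp) (v := fun _ => ‖v‖⁻¹ • v) (s := {0}) (by
      refine ⟨fun i => h1, fun i j hij => absurd (Subsingleton.elim i j) hij⟩)
  exact ⟨b, hb 0 rfl⟩

/-- The factor `2` comes from adding the integral to its image under `n ↦ -n`. The sum is radial and
no longer involves `H`. -/
lemma lintegral_pairWeight_plane (lam : ℝ≥0) {H : Set E3} (hH : IsPlaneOrientation H) {A : Set ℝ}
    (hA : MeasurableSet A) {v : E3} (hv : v ≠ 0) {b : OrthonormalBasis (Fin 3) ℝ E3}
    (hb : b 0 = ‖v‖⁻¹ • v) :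
    2 * ∫⁻ w : ℝ × ℝ, pairWeight lam H A v (w.1 • b 1 + w.2 • b 2) =
      sliceIntegral lam A ‖v‖ := by
  have hbv : v = ‖v‖ • b 0 := by
    rw [hb, smul_smul, mul_inv_cancel₀ (norm_ne_zero_iff.2 hv), one_smul]
  have horth : ∀ w : ℝ × ℝ, inner ℝ v (w.1 • b 1 + w.2 • b 2) = 0 := by
    intro w
    rw [hbv, inner_smul_left, inner_add_right, inner_smul_right, inner_smul_right,
      b.inner_eq_zero (by decide), b.inner_eq_zero (by decide)]
    simp
  have hnorm : ∀ w : ℝ × ℝ, ‖w.1 • b 1 + w.2 • b 2‖ = √(w.1 ^ 2 + w.2 ^ 2) := by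
    intro w
    rw [← Real.sqrt_sq (norm_nonneg _), norm_add_sq_real, inner_smul_left, inner_smul_right,
      b.inner_eq_zero (by decide), norm_smul, norm_smul, b.norm_eq_one, b.norm_eq_one]
    simp
  have hne : ∀ᵐ w : ℝ × ℝ, w.1 • b 1 + w.2 • b 2 ≠ 0 := by
    have h0 : ∀ᵐ w : ℝ × ℝ, w ≠ 0 := by
      rw [ae_iff]
      simp
    filter_upwards [h0] with w hw h
    refine hw ?_
    have h1 := hnorm w
    rw [h, norm_zero, eq_comm, Real.sqrt_eq_zero (by positivity)] at h1
    have h2 : w.1 ^ 2 = 0 := by nlinarith [sq_nonneg w.1, sq_nonneg w.2]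
    have h3 : w.2 ^ 2 = 0 := by nlinarith [sq_nonneg w.1, sq_nonneg w.2]
    exact Prod.ext (by simpa using h2) (by simpa using h3)
  have hmn : Measurable fun w : ℝ × ℝ => w.1 • b 1 + w.2 • b 2 := by fun_prop
  have hm : Measurable fun w : ℝ × ℝ => pairWeight lam H A v (w.1 • b 1 + w.2 • b 2) :=
    measurable_pairWeight lam hH.measurable hA measurable_const hmn
  have hneg : ∫⁻ w : ℝ × ℝ, pairWeight lam H A v (w.1 • b 1 + w.2 • b 2) =
      ∫⁻ w : ℝ × ℝ, pairWeight lam H A v (-(w.1 • b 1 + w.2 • b 2)) := by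
    rw [← lintegral_neg_eq_self]
    refine lintegral_congr fun w => ?_
    congr 1
    simp only [Prod.fst_neg, Prod.snd_neg]
    module
  have hs : ∀ ρ : ℝ, Measurable (sliceWeight lam A ρ) := fun ρ =>
    Measurable.of_uncurry_left (f := sliceWeight lam A) (measurable_sliceWeight lam hA)
  rw [sliceIntegral, ← lintegral_radial (hs _), two_mul]
  conv_lhs => arg 2; rw [hneg]
  rw [← lintegral_add_left hm]
  refine lintegral_congr_ae ?_
  filter_upwards [hne] with w hw
  rw [pairWeight_add_neg lam hH A hv hw (horth w), hnorm]

/-- In an orthonormal basis with `b 0` along `v`, the abscissa is `t / δ`, where `t` is the first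
coordinate of `s` and `δ = ⟪v, d⟫ / ‖v‖`. Subtracting `(t / δ) • d` removes that coordinate and
shifts the other two by an amount depending on `t` alone, which translation invariance absorbs. The
integral over `t` then yields `|δ| |B|`. -/
lemma lintegral_pairWeight (lam : ℝ≥0) {H : Set E3} (hH : IsPlaneOrientation H) {B A : Set ℝ}
    (hB : MeasurableSet B) (hA : MeasurableSet A) {v d : E3} (hvd : inner ℝ v d ≠ 0) :
    2 * ∫⁻ s, B.indicator 1 (inner ℝ v s / inner ℝ v d) *
        pairWeight lam H A v (s - (inner ℝ v s / inner ℝ v d) • d) =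
      ENNReal.ofReal (|inner ℝ v d| / ‖v‖) * volume B * sliceIntegral lam A ‖v‖ := by
  have hv : v ≠ 0 := fun h => hvd (by rw [h, inner_zero_left])
  have hv' := norm_ne_zero_iff.2 hv
  obtain ⟨b, hb⟩ := exists_orthonormalBasis hv
  rw [← lintegral_pairWeight_plane lam hH hA hv hb]
  have hbv : v = ‖v‖ • b 0 := by
    rw [hb, smul_smul, mul_inv_cancel₀ hv', one_smul]
  set δ := inner ℝ v d / ‖v‖ with hδ
  have hδ0 : δ ≠ 0 := div_ne_zero hvd hv'
  have hinner : ∀ (t : ℝ) (w : ℝ × ℝ),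
      inner ℝ v (t • b 0 + w.1 • b 1 + w.2 • b 2) / inner ℝ v d = t * δ⁻¹ := by
    intro t w
    have : inner ℝ v (t • b 0 + w.1 • b 1 + w.2 • b 2) = ‖v‖ * t := by
      conv_lhs => rw [hbv]
      rw [inner_smul_left, inner_add_right, inner_add_right, inner_smul_right, inner_smul_right,
        inner_smul_right, b.inner_eq_zero (by decide : (0 : Fin 3) ≠ 1),
        b.inner_eq_zero (by decide : (0 : Fin 3) ≠ 2), b.inner_eq_one]
      simp
    rw [this, hδ]
    field_simp
  have hd : d = δ • b 0 + inner ℝ (b 1) d • b 1 + inner ℝ (b 2) d • b 2 := by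
    have h0 : inner ℝ (b 0) d = δ := by
      rw [hb, inner_smul_left, hδ]
      simp
      ring
    have := b.sum_repr' d
    rw [Fin.sum_univ_three, h0] at this
    exact this.symm
  have hmF : Measurable fun s : E3 => B.indicator (1 : ℝ → ℝ≥0∞) (inner ℝ v s / inner ℝ v d) *
      pairWeight lam H A v (s - (inner ℝ v s / inner ℝ v d) • d) := by
    have h1 : Measurable fun s : E3 => (inner ℝ v s : ℝ) / inner ℝ v d := by fun_prop
    exact ((measurable_one.indicator hB).comp h1).mul (measurable_pairWeight lam hH.measurable hA
      measurable_const (measurable_id.sub (h1.smul_const d)))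
  rw [lintegral_orthonormalBasis b hmF]
  have hsub : ∀ (t : ℝ) (w : ℝ × ℝ), t • b 0 + w.1 • b 1 + w.2 • b 2 - (t * δ⁻¹) • d =
      (w - (t * δ⁻¹) • (inner ℝ (b 1) d, inner ℝ (b 2) d)).1 • b 1 +
      (w - (t * δ⁻¹) • (inner ℝ (b 1) d, inner ℝ (b 2) d)).2 • b 2 := by
    intro t w
    generalize inner ℝ (b 1) d = d1 at *
    generalize inner ℝ (b 2) d = d2 at *
    have e : (t * δ⁻¹) • δ • b 0 = t • b 0 := by
      rw [smul_smul, mul_assoc, inv_mul_cancel₀ hδ0, mul_one]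
    rw [hd, smul_add, smul_add, e]
    simp only [Prod.fst_sub, Prod.snd_sub, Prod.smul_fst, Prod.smul_snd, smul_eq_mul]
    module
  have hinner2 : ∀ t : ℝ, ∫⁻ w : ℝ × ℝ, B.indicator (1 : ℝ → ℝ≥0∞)
      (inner ℝ v (t • b 0 + w.1 • b 1 + w.2 • b 2) / inner ℝ v d) *
      pairWeight lam H A v (t • b 0 + w.1 • b 1 + w.2 • b 2 -
        (inner ℝ v (t • b 0 + w.1 • b 1 + w.2 • b 2) / inner ℝ v d) • d) =
      B.indicator (1 : ℝ → ℝ≥0∞) (t * δ⁻¹) *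
        ∫⁻ w : ℝ × ℝ, pairWeight lam H A v (w.1 • b 1 + w.2 • b 2) := by
    intro t
    simp only [hinner, hsub]
    rw [lintegral_const_mul', lintegral_sub_right_eq_self
      (fun w : ℝ × ℝ => pairWeight lam H A v (w.1 • b 1 + w.2 • b 2))]
    by_cases h : t * δ⁻¹ ∈ B <;> simp [h]
  simp only [hinner2]
  have hmB : Measurable fun t : ℝ => B.indicator (1 : ℝ → ℝ≥0∞) (t * δ⁻¹) :=
    (measurable_one.indicator hB).comp (by fun_prop)
  have hvolB : ∫⁻ t : ℝ, B.indicator (1 : ℝ → ℝ≥0∞) (t * δ⁻¹) = ENNReal.ofReal |δ| * volume B := by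
    have : ∀ t : ℝ, B.indicator (1 : ℝ → ℝ≥0∞) (t * δ⁻¹) =
        ((fun t => t * δ⁻¹) ⁻¹' B).indicator 1 t := fun t => rfl
    simp only [this]
    rw [lintegral_indicator_one ((by fun_prop : Measurable fun t : ℝ => t * δ⁻¹) hB),
      Real.volume_preimage_mul_right (inv_ne_zero hδ0), inv_inv]
  rw [lintegral_mul_const _ hmB, hvolB, hδ, abs_div, abs_norm]
  ring

end Slices

/-! ### Assembling the integral over pairs of nuclei -/

section PairIntegral

lemma orientedAngle_congr (H : Set E3) {X x Y X' x' Y' : E3} (hX : X - x = X' - x')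
    (hY : Y - x = Y' - x') : orientedAngle H X x Y = orientedAngle H X' x' Y' := by
  unfold orientedAngle
  rw [hX, hY]

/-- The map `v ↦ -v` exchanges `{0 ≺ v}` and `{v ≺ 0}`, which are complementary up to a null set. -/
lemma IsPairOrder.two_mul_lintegral {r : E3 → E3 → Prop} (hr : IsPairOrder r) {f : E3 → ℝ≥0∞}
    (heven : ∀ v, f (-v) = f v) :
    2 * ∫⁻ v in {v | r 0 v}, f v = ∫⁻ v, f v := by
  have hneg : ∀ v, r 0 (-v) ↔ r v 0 := fun v => by rw [hr.iff_sub v 0, zero_sub]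
  have hm := hr.measurable
  have h1 : ∫⁻ v in {v | r 0 v}, f v = ∫⁻ v in {v | r v 0}, f v := by
    have hm' : MeasurableSet {v | r v 0} := by
      have : {v | r v 0} = Neg.neg ⁻¹' {v | r 0 v} := by
        ext v
        exact (hneg v).symm
      rw [this]
      exact measurable_neg hm
    rw [← lintegral_indicator hm, ← lintegral_indicator hm', ← lintegral_neg_eq_self]
    refine lintegral_congr fun v => ?_
    by_cases h : r v 0
    · simp [indicator, h, (hneg v).2 h, heven]
    · simp [indicator, h, mt (hneg v).1 h]
  have h2 : ∫⁻ v in {v | r v 0}, f v = ∫⁻ v in {v | r 0 v}ᶜ, f v := by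
    refine setLIntegral_congr ?_
    filter_upwards [hr.ae_total] with v hv
    refine propext ⟨fun h h' => hr.irrefl _ (hr.trans _ _ _ h h'), fun h => hv.resolve_left h⟩
  rw [two_mul]
  nth_rw 2 [h1]
  rw [h2, lintegral_add_compl _ hm]

/-- The factor `4` is `2` for the orientation (`n ↦ -n`) times `2` for the order (`v ↦ -v`). The
right-hand side depends on neither convention. -/
lemma lintegral_anglePairs (lam : ℝ≥0) {r : E3 → E3 → Prop} (hr : IsPairOrder r) {H : Set E3}
    (hH : IsPlaneOrientation H) (p : E3) (d : E3) {B A : Set ℝ} (hB : MeasurableSet B)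
    (hA : MeasurableSet A) :
    4 * ∫⁻ q in anglePairs r H p d B A,
      voidProb lam (Metric.ball (bisectorPoint p d q) (bisectorRadius p d q)) =
    volume B * ∫⁻ v, ENNReal.ofReal (|inner ℝ v d| / ‖v‖) * sliceIntegral lam A ‖v‖ := by
  classical
  simp only [voidProb_ball]
  have hS := measurableSet_anglePairs hr hH p d hB hA
  have hmf : Measurable fun q => ballVoidProb lam (bisectorRadius p d q) :=
    (measurable_ballVoidProb lam).comp (measurable_bisectorRadius p d)
  rw [← lintegral_indicator hS, lintegral_pairs p (hmf.indicator hS)]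
  have hpt : ∀ v s : E3, (anglePairs r H p d B A).indicator
      (fun q => ballVoidProb lam (bisectorRadius p d q))
      (p + s - (2⁻¹ : ℝ) • v, p + s + (2⁻¹ : ℝ) • v) =
      (if inner ℝ v d ≠ 0 ∧ r 0 v then 1 else 0) *
        (B.indicator 1 (inner ℝ v s / inner ℝ v d) *
        pairWeight lam H A v (s - (inner ℝ v s / inner ℝ v d) • d)) := by
    intro v s
    have e1 : p + s + (2⁻¹ : ℝ) • v - (p + s - (2⁻¹ : ℝ) • v) = v := by module
    have e2 : (2⁻¹ : ℝ) • (p + s - (2⁻¹ : ℝ) • v + (p + s + (2⁻¹ : ℝ) • v)) - p = s := by module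
    have hz : bisectorAbscissa p d (p + s - (2⁻¹ : ℝ) • v, p + s + (2⁻¹ : ℝ) • v) =
        inner ℝ v s / inner ℝ v d := by
      rw [bisectorAbscissa]
      simp only [e1, e2]
    have hc : bisectorPoint p d (p + s - (2⁻¹ : ℝ) • v, p + s + (2⁻¹ : ℝ) • v) =
        p + (inner ℝ v s / inner ℝ v d : ℝ) • d := by
      rw [bisectorPoint, hz, linePoint]
    set ζ : ℝ := inner ℝ v s / inner ℝ v d
    have ex : p + s - (2⁻¹ : ℝ) • v - (p + ζ • d) = (s - ζ • d - (2⁻¹ : ℝ) • v) := by abel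
    have ey : p + s + (2⁻¹ : ℝ) • v - (p + ζ • d) = (s - ζ • d + (2⁻¹ : ℝ) • v) := by abel
    have hR : bisectorRadius p d (p + s - (2⁻¹ : ℝ) • v, p + s + (2⁻¹ : ℝ) • v) =
        ‖s - ζ • d - (2⁻¹ : ℝ) • v‖ := by
      rw [bisectorRadius, hc, dist_eq_norm, ex]
    have ho : orientedAngle H (p + s - (2⁻¹ : ℝ) • v)
        (bisectorPoint p d (p + s - (2⁻¹ : ℝ) • v, p + s + (2⁻¹ : ℝ) • v))
        (p + s + (2⁻¹ : ℝ) • v) =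
        orientedAngle H (s - ζ • d - (2⁻¹ : ℝ) • v) 0 (s - ζ • d + (2⁻¹ : ℝ) • v) := by
      rw [hc]
      exact orientedAngle_congr H (by rw [ex, sub_zero]) (by rw [ey, sub_zero])
    have hmem : (p + s - (2⁻¹ : ℝ) • v, p + s + (2⁻¹ : ℝ) • v) ∈ anglePairs r H p d B A ↔
        (inner ℝ v d ≠ 0 ∧ r 0 v) ∧ ζ ∈ B ∧
        orientedAngle H (s - ζ • d - (2⁻¹ : ℝ) • v) 0 (s - ζ • d + (2⁻¹ : ℝ) • v) ∈ A := by
      simp only [anglePairs, mem_ofPred_eq, ho, hz, e1, hr.iff_sub (p + s - (2⁻¹ : ℝ) • v)]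
      tauto
    simp only [indicator, hmem, hR, pairWeight]
    by_cases h1 : inner ℝ v d ≠ 0 ∧ r 0 v <;> by_cases h2 : ζ ∈ B <;>
      by_cases h3 : orientedAngle H (s - ζ • d - (2⁻¹ : ℝ) • v) 0
        (s - ζ • d + (2⁻¹ : ℝ) • v) ∈ A <;> simp [h1, h2, h3]
  simp only [hpt]
  have hinner : ∀ v : E3, 2 * ∫⁻ s : E3, (if inner ℝ v d ≠ 0 ∧ r 0 v then (1 : ℝ≥0∞) else 0) *
        (B.indicator 1 (inner ℝ v s / inner ℝ v d) *
        pairWeight lam H A v (s - (inner ℝ v s / inner ℝ v d) • d)) =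
      {v | r 0 v}.indicator (fun v => volume B *
        (ENNReal.ofReal (|inner ℝ v d| / ‖v‖) * sliceIntegral lam A ‖v‖)) v := by
    intro v
    rw [lintegral_const_mul' _ _ (by split_ifs <;> simp), mul_left_comm]
    -- For a bisector parallel to the line both sides vanish: the left by its indicator, the right
    -- by its factor `|⟪v, d⟫|`.
    by_cases h : inner ℝ v d = 0
    · simp [h, indicator]
    rw [lintegral_pairWeight lam hH hB hA h]
    simp only [indicator, mem_ofPred_eq]
    by_cases h' : r 0 v
    · rw [if_pos ⟨h, h'⟩, if_pos h']
      ring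
    · rw [if_neg (fun h2 => h' h2.2), if_neg h', zero_mul]
  have hm : Measurable fun v : E3 =>
      ENNReal.ofReal (|inner ℝ v d| / ‖v‖) * sliceIntegral lam A ‖v‖ := by
    refine Measurable.mul ?_ ((measurable_sliceIntegral lam hA).comp measurable_norm)
    have : Measurable fun v : E3 => |(inner ℝ v d : ℝ)| := by
      have h : Measurable fun v : E3 => (inner ℝ v d : ℝ) := by fun_prop
      exact h.abs
    exact (this.div measurable_norm).ennreal_ofReal
  rw [show (4 : ℝ≥0∞) = 2 * 2 by norm_num, mul_assoc, ← lintegral_const_mul' 2 _ (by simp)]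
  simp only [hinner]
  rw [lintegral_indicator hr.measurable, hr.two_mul_lintegral (fun v => by
    rw [inner_neg_left, abs_neg, norm_neg]), lintegral_const_mul _ hm]

end PairIntegral

/-! ### Polar coordinates in the quadrant -/

section PlanePolar

lemma cos_pos_sin_pos_iff {φ : ℝ} (h : φ ∈ Ioo (-Real.pi) Real.pi) :
    (0 < Real.cos φ ∧ 0 < Real.sin φ) ↔ φ ∈ Ioo 0 (Real.pi / 2) := by
  constructor
  · rintro ⟨hc, hs⟩
    constructor
    · by_contra h0
      exact absurd (Real.sin_nonpos_of_nonpos_of_neg_pi_le (not_lt.1 h0) h.1.le) (not_le.2 hs)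
    · by_contra h0
      exact absurd (Real.cos_nonpos_of_pi_div_two_le_of_le (not_lt.1 h0)
        (by linarith [h.2, Real.pi_pos])) (not_le.2 hc)
  · rintro ⟨h1, h2⟩
    exact ⟨Real.cos_pos_of_mem_Ioo ⟨by linarith [Real.pi_pos], h2⟩,
      Real.sin_pos_of_pos_of_lt_pi h1 h.2⟩

lemma setLIntegral_Ioi_eq_two_mul {f : ℝ → ℝ≥0∞} (hf : Measurable f) :
    ∫⁻ ρ in Ioi (0 : ℝ), f ρ = 2 * ∫⁻ q in Ioi (0 : ℝ), f (2 * q) := by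
  rw [← lintegral_indicator measurableSet_Ioi, ← lintegral_indicator measurableSet_Ioi,
    lintegral_eq_mul_lintegral_comp_mul_left two_ne_zero (hf.indicator measurableSet_Ioi)]
  congr 1
  · simp
  · refine lintegral_congr fun q => ?_
    simp [indicator]

/-- Substitution `s = R cos φ`, `ρ / 2 = R sin φ`; the factor `2` is the Jacobian of halving `ρ`.
Here `R` will be the distance from the crossing to its nuclei. -/
lemma lintegral_quadrant {f : ℝ → ℝ → ℝ≥0∞} (hf : Measurable fun q : ℝ × ℝ => f q.1 q.2) :
    ∫⁻ ρ in Ioi (0 : ℝ), ∫⁻ s in Ioi (0 : ℝ), f ρ s =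
      2 * ∫⁻ R in Ioi (0 : ℝ), ∫⁻ φ in Ioo 0 (Real.pi / 2),
        ENNReal.ofReal R * f (2 * (R * Real.sin φ)) (R * Real.cos φ) := by
  have hf2 : Measurable fun q : ℝ × ℝ => f (2 * q.2) q.1 :=
    hf.comp (by fun_prop : Measurable fun q : ℝ × ℝ => (2 * q.2, q.1))
  have hQ : MeasurableSet (Ioi (0 : ℝ) ×ˢ Ioi (0 : ℝ)) := measurableSet_Ioi.prod measurableSet_Ioi
  rw [setLIntegral_Ioi_eq_two_mul (Measurable.lintegral_prod_right' hf)]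
  congr 1
  rw [lintegral_lintegral_swap (by
    refine Measurable.aemeasurable ?_
    exact hf.comp (by fun_prop : Measurable fun q : ℝ × ℝ => (2 * q.1, q.2)))]
  have e1 := lintegral_prod (μ := volume.restrict (Ioi (0 : ℝ))) (ν := volume.restrict (Ioi (0 : ℝ)))
    (fun q : ℝ × ℝ => f (2 * q.2) q.1) hf2.aemeasurable
  simp only at e1
  rw [← e1, Measure.prod_restrict, ← Measure.volume_eq_prod, ← lintegral_indicator hQ,
    ← lintegral_comp_polarCoord_symm, polarCoord_target]
  have hT : MeasurableSet (Ioi (0 : ℝ) ×ˢ Ioo (-Real.pi) Real.pi) :=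
    measurableSet_Ioi.prod measurableSet_Ioo
  have hT' : MeasurableSet (Ioi (0 : ℝ) ×ˢ Ioo 0 (Real.pi / 2)) :=
    measurableSet_Ioi.prod measurableSet_Ioo
  have hmg : Measurable fun w : ℝ × ℝ =>
      ENNReal.ofReal w.1 * f (2 * (w.1 * Real.sin w.2)) (w.1 * Real.cos w.2) := by
    have := hf.comp (by fun_prop : Measurable fun w : ℝ × ℝ =>
      (2 * (w.1 * Real.sin w.2), w.1 * Real.cos w.2))
    exact (by fun_prop : Measurable fun w : ℝ × ℝ => ENNReal.ofReal w.1).mul this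
  have e2 := lintegral_prod (μ := volume.restrict (Ioi (0 : ℝ)))
    (ν := volume.restrict (Ioo 0 (Real.pi / 2))) _ hmg.aemeasurable
  simp only at e2
  rw [← e2, Measure.prod_restrict, ← Measure.volume_eq_prod, ← lintegral_indicator hT,
    ← lintegral_indicator hT']
  refine lintegral_congr ?_
  rintro ⟨R, φ⟩
  simp only [indicator, mem_prod, mem_Ioi, polarCoord_symm_apply, smul_eq_mul]
  by_cases hR : 0 < R
  · by_cases hφ : φ ∈ Ioo (-Real.pi) Real.pi
    · have h3 := cos_pos_sin_pos_iff hφ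
      simp only [hR, hφ, true_and, if_true, mul_pos_iff_of_pos_left, h3, mul_ite, mul_zero]
    · have h4 : φ ∉ Ioo 0 (Real.pi / 2) := fun h => hφ ⟨by linarith [h.1, Real.pi_pos],
        by linarith [h.2, Real.pi_pos]⟩
      simp only [hφ, h4, and_false, if_false]
  · simp only [hR, false_and, if_false]

end PlanePolar

/-! ### Separation of angle and radius -/

section Density

/-- The density of the Palm distribution of the angle. -/
def angleDensity (t : ℝ) : ℝ≥0∞ :=
  ENNReal.ofReal (3 / 4 * |Real.cos (t / 2)| * Real.sin (t / 2) ^ 2)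

lemma measurable_angleDensity : Measurable angleDensity := by
  unfold angleDensity
  exact (by fun_prop : Measurable fun t : ℝ =>
    3 / 4 * |Real.cos (t / 2)| * Real.sin (t / 2) ^ 2).ennreal_ofReal

lemma angleDensity_two_pi_sub (t : ℝ) : angleDensity (2 * Real.pi - t) = angleDensity t := by
  unfold angleDensity
  rw [show (2 * Real.pi - t) / 2 = Real.pi - t / 2 by ring, Real.cos_pi_sub, Real.sin_pi_sub,
    abs_neg]

/-- The density is symmetric about `π`, so the term with `2π - t` accounts for the angles in `(π,
2π)`; the point `π` is null. -/
lemma lintegral_angleWeight_mul {A : Set ℝ} (hA : MeasurableSet A) :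
    ∫⁻ t in Ioo 0 Real.pi, angleDensity t * angleWeight A t =
      ∫⁻ t in A ∩ Ioo 0 (2 * Real.pi), angleDensity t := by
  set F : ℝ → ℝ≥0∞ := A.indicator angleDensity with hF
  have hFm : Measurable F := measurable_angleDensity.indicator hA
  have hpt : ∀ t, angleDensity t * angleWeight A t = F t + F (2 * Real.pi - t) := by
    intro t
    simp only [hF, angleWeight, mul_add, indicator, angleDensity_two_pi_sub]
    congr 1 <;> split_ifs <;> simp
  simp only [hpt]
  rw [lintegral_add_left hFm]
  have hrefl : ∫⁻ t in Ioo 0 Real.pi, F (2 * Real.pi - t) =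
      ∫⁻ t in Ioo Real.pi (2 * Real.pi), F t := by
    rw [← lintegral_indicator measurableSet_Ioo, ← lintegral_indicator measurableSet_Ioo,
      ← lintegral_sub_left_eq_self _ (2 * Real.pi)]
    refine lintegral_congr fun t => ?_
    have : 2 * Real.pi - t ∈ Ioo 0 Real.pi ↔ t ∈ Ioo Real.pi (2 * Real.pi) := by
      simp only [mem_Ioo]
      constructor <;> rintro ⟨h1, h2⟩ <;> constructor <;> linarith
    simp only [indicator, this, sub_sub_cancel]
    split_ifs <;> rfl
  have hdisj : Disjoint (Ioo 0 Real.pi) (Ioo Real.pi (2 * Real.pi)) := by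
    rw [Set.disjoint_left]
    rintro t ⟨-, h1⟩ ⟨h2, -⟩
    exact lt_asymm h1 h2
  have hae : (Ioo 0 Real.pi ∪ Ioo Real.pi (2 * Real.pi) : Set ℝ) =ᵐ[volume]
      Ioo 0 (2 * Real.pi) := by
    have h0 : ∀ᵐ t : ℝ, t ≠ Real.pi := by
      rw [ae_iff]
      simp
    filter_upwards [h0] with t ht
    refine propext ⟨?_, fun h => ?_⟩
    · rintro (h | h)
      · exact ⟨h.1, by linarith [h.2, Real.pi_pos]⟩
      · exact ⟨by linarith [h.1, Real.pi_pos], h.2⟩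
    · rcases lt_or_gt_of_ne ht with h' | h'
      · exact Or.inl ⟨h.1, h'⟩
      · exact Or.inr ⟨h', h.2⟩
  rw [hrefl, ← lintegral_union measurableSet_Ioo hdisj, setLIntegral_congr hae, hF,
    setLIntegral_indicator hA]

/-- Up to `π` the cosine is nonnegative, and `sin³ (t/2) / 2` is an antiderivative. -/
lemma lintegral_angleDensity_Ioo {a b : ℝ} (ha : 0 ≤ a) (hab : a ≤ b) (hb : b ≤ Real.pi) :
    ∫⁻ t in Ioo a b, angleDensity t =
      ENNReal.ofReal (1 / 2 * (Real.sin (b / 2) ^ 3 - Real.sin (a / 2) ^ 3)) := by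
  have hcont : Continuous fun t : ℝ => 3 / 4 * |Real.cos (t / 2)| * Real.sin (t / 2) ^ 2 := by
    fun_prop
  have hcont' : Continuous fun t : ℝ => 3 / 4 * Real.cos (t / 2) * Real.sin (t / 2) ^ 2 := by
    fun_prop
  have hint : ∫ t in a..b, 3 / 4 * Real.cos (t / 2) * Real.sin (t / 2) ^ 2 =
      1 / 2 * Real.sin (b / 2) ^ 3 - 1 / 2 * Real.sin (a / 2) ^ 3 := by
    refine intervalIntegral.integral_eq_sub_of_hasDerivAt
      (f := fun t => 1 / 2 * Real.sin (t / 2) ^ 3) (fun t _ => ?_) (hcont'.intervalIntegrable _ _)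
    have h1 : HasDerivAt (fun t : ℝ => t / 2) (1 / 2) t := (hasDerivAt_id t).div_const 2
    have := (h1.sin.pow 3).const_mul (1 / 2)
    refine this.congr_deriv ?_
    norm_num
    ring
  unfold angleDensity
  rw [← ofReal_integral_eq_lintegral_ofReal
    ((hcont.integrableOn_Icc (a := a) (b := b)).mono_set Ioo_subset_Icc_self)
    (ae_of_all _ fun t => by positivity), ← integral_Ioc_eq_integral_Ioo,
    ← intervalIntegral.integral_of_le hab]
  congr 1
  rw [mul_sub, ← hint]
  refine intervalIntegral.integral_congr fun t ht => ?_
  rw [uIcc_of_le hab] at ht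
  have : 0 ≤ Real.cos (t / 2) := Real.cos_nonneg_of_mem_Icc
    ⟨by linarith [ht.1, Real.pi_pos], by linarith [ht.2]⟩
  simp only [abs_of_nonneg this]

lemma lintegral_angleDensity : ∫⁻ t in Ioo 0 (2 * Real.pi), angleDensity t = 1 := by
  have h := lintegral_angleWeight_mul MeasurableSet.univ
  rw [univ_inter] at h
  rw [← h]
  simp only [angleWeight, indicator_univ, Pi.one_apply]
  rw [lintegral_mul_const _ measurable_angleDensity,
    lintegral_angleDensity_Ioo le_rfl Real.pi_pos.le le_rfl, one_add_one_eq_two]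
  rw [zero_div, Real.sin_pi_div_two, Real.sin_zero]
  rw [show (2 : ℝ≥0∞) = ENNReal.ofReal 2 by simp, ← ENNReal.ofReal_mul (by norm_num)]
  norm_num

lemma lintegral_angleDensity_two_mul {A : Set ℝ} (hA : MeasurableSet A) :
    2 * ∫⁻ φ in Ioo 0 (Real.pi / 2), angleDensity (2 * φ) * angleWeight A (2 * φ) =
      ∫⁻ t in A ∩ Ioo 0 (2 * Real.pi), angleDensity t := by
  have hm : Measurable fun t => angleDensity t * angleWeight A t :=
    measurable_angleDensity.mul (measurable_angleWeight hA)
  rw [← lintegral_angleWeight_mul hA, ← lintegral_indicator measurableSet_Ioo,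
    ← lintegral_indicator measurableSet_Ioo,
    lintegral_eq_mul_lintegral_comp_mul_left two_ne_zero (hm.indicator measurableSet_Ioo)]
  congr 1
  · simp
  · refine lintegral_congr fun φ => ?_
    have : 2 * φ ∈ Ioo 0 Real.pi ↔ φ ∈ Ioo 0 (Real.pi / 2) := by
      simp only [mem_Ioo]
      constructor <;> rintro ⟨h1, h2⟩ <;> constructor <;> linarith
    simp only [indicator, this]

/-- An isosceles triangle with legs `R` and half base `R sin φ` has apex angle `2φ`. -/
lemma viewAngle_polar {R φ : ℝ} (hR : 0 < R) (hφ : φ ∈ Ioo 0 (Real.pi / 2)) :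
    viewAngle (2 * (R * Real.sin φ)) (R * Real.cos φ) = 2 * φ := by
  rw [viewAngle]
  have e1 : (R * Real.cos φ) ^ 2 - (2 * (R * Real.sin φ) / 2) ^ 2 = R ^ 2 * Real.cos (2 * φ) := by
    rw [Real.cos_two_mul']
    ring
  have e2 : (R * Real.cos φ) ^ 2 + (2 * (R * Real.sin φ) / 2) ^ 2 = R ^ 2 := by
    linear_combination R ^ 2 * Real.sin_sq_add_cos_sq φ
  rw [e1, e2, mul_div_cancel_left₀ _ (by positivity), Real.arccos_cos (by linarith [hφ.1])
    (by linarith [hφ.2])]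

/-- The radial factor of the intensity of crossings. -/
def radialFactor (lam : ℝ≥0) : ℝ≥0∞ :=
  ∫⁻ R in Ioi (0 : ℝ), ENNReal.ofReal (16 / 3 * R ^ 4) * ballVoidProb lam R

lemma lintegral_sliceIntegral (lam : ℝ≥0) {A : Set ℝ} (hA : MeasurableSet A) :
    ∫⁻ ρ in Ioi (0 : ℝ), ENNReal.ofReal (ρ ^ 2) * sliceIntegral lam A ρ =
      ENNReal.ofReal (2 * Real.pi) * radialFactor lam *
        ∫⁻ t in A ∩ Ioo 0 (2 * Real.pi), angleDensity t := by
  set f : ℝ → ℝ → ℝ≥0∞ := fun ρ s =>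
    ENNReal.ofReal (ρ ^ 2) * (ENNReal.ofReal s * sliceWeight lam A ρ s) with hf
  have hmf : Measurable fun q : ℝ × ℝ => f q.1 q.2 :=
    (by fun_prop : Measurable fun q : ℝ × ℝ => ENNReal.ofReal (q.1 ^ 2)).mul
      ((by fun_prop : Measurable fun q : ℝ × ℝ => ENNReal.ofReal q.2).mul
        (measurable_sliceWeight lam hA))
  have h1 : ∀ ρ, ENNReal.ofReal (ρ ^ 2) * sliceIntegral lam A ρ =
      ENNReal.ofReal (2 * Real.pi) * ∫⁻ s in Ioi (0 : ℝ), f ρ s := by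
    intro ρ
    rw [sliceIntegral, lintegral_const_mul' _ _ ENNReal.ofReal_ne_top]
    ring
  simp only [h1]
  rw [lintegral_const_mul' _ _ ENNReal.ofReal_ne_top, lintegral_quadrant hmf, mul_assoc]
  congr 1
  have hmW : Measurable fun φ : ℝ => angleDensity (2 * φ) * angleWeight A (2 * φ) :=
    (measurable_angleDensity.comp (by fun_prop)).mul
      ((measurable_angleWeight hA).comp (by fun_prop))
  have h2 : ∀ R ∈ Ioi (0 : ℝ), ∫⁻ φ in Ioo 0 (Real.pi / 2),
      ENNReal.ofReal R * f (2 * (R * Real.sin φ)) (R * Real.cos φ) =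
      ENNReal.ofReal (16 / 3 * R ^ 4) * ballVoidProb lam R *
        ∫⁻ φ in Ioo 0 (Real.pi / 2), angleDensity (2 * φ) * angleWeight A (2 * φ) := by
    intro R hR
    have hR' : 0 < R := hR
    rw [← lintegral_const_mul _ hmW]
    refine setLIntegral_congr_fun measurableSet_Ioo fun φ hφ => ?_
    have hc : 0 ≤ Real.cos φ := Real.cos_nonneg_of_mem_Icc
      ⟨by linarith [hφ.1, Real.pi_pos], hφ.2.le⟩
    have e2 : (R * Real.cos φ) ^ 2 + (2 * (R * Real.sin φ) / 2) ^ 2 = R ^ 2 := by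
      linear_combination R ^ 2 * Real.sin_sq_add_cos_sq φ
    -- The Jacobian `R`, the radial weight `ρ²` and the planar weight `s` multiply to `4 R⁴ sin² φ
    -- cos φ`. Writing `4 = 16/3 · 3/4` splits off the normalised density at `2φ`.
    have e3 : ENNReal.ofReal R * (ENNReal.ofReal ((2 * (R * Real.sin φ)) ^ 2) *
        ENNReal.ofReal (R * Real.cos φ)) = ENNReal.ofReal (16 / 3 * R ^ 4) * angleDensity (2 * φ) := by
      rw [angleDensity, ← ENNReal.ofReal_mul (by positivity), ← ENNReal.ofReal_mul (by positivity),
        ← ENNReal.ofReal_mul (by positivity), mul_div_cancel_left₀ _ two_ne_zero,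
        abs_of_nonneg hc]
      congr 1
      ring
    simp only [hf, sliceWeight, viewAngle_polar hR' hφ, e2, Real.sqrt_sq hR'.le]
    calc _ = (ENNReal.ofReal R * (ENNReal.ofReal ((2 * (R * Real.sin φ)) ^ 2) *
          ENNReal.ofReal (R * Real.cos φ))) * (angleWeight A (2 * φ) * ballVoidProb lam R) := by ring
      _ = _ := by rw [e3]; ring
  rw [setLIntegral_congr_fun measurableSet_Ioi h2, lintegral_mul_const _ (by
      exact (by fun_prop : Measurable fun R : ℝ => ENNReal.ofReal (16 / 3 * R ^ 4)).mul
        (measurable_ballVoidProb lam)), mul_left_comm, lintegral_angleDensity_two_mul hA]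
  rfl

lemma ballVoidProb_pos (lam : ℝ≥0) (ρ : ℝ) : 0 < ballVoidProb lam ρ :=
  ENNReal.ofReal_pos.2 (Real.exp_pos _)

lemma radialFactor_pos (lam : ℝ≥0) : radialFactor lam ≠ 0 := by
  have hm : Measurable fun R : ℝ => ENNReal.ofReal (16 / 3 * R ^ 4) * ballVoidProb lam R :=
    (by fun_prop : Measurable fun R : ℝ => ENNReal.ofReal (16 / 3 * R ^ 4)).mul
        (measurable_ballVoidProb lam)
  rw [radialFactor, Ne, setLIntegral_eq_zero_iff measurableSet_Ioi hm]
  intro h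
  have h0 : volume (Ioi (0 : ℝ)) = 0 := by
    refine measure_mono_null (fun R (hR : 0 < R) => ?_) (ae_iff.1 h)
    have h1 : 0 < ENNReal.ofReal (16 / 3 * R ^ 4) := ENNReal.ofReal_pos.2 (by positivity)
    intro h2
    exact (ENNReal.mul_pos h1.ne' (ballVoidProb_pos lam R).ne').ne' (h2 hR)
  simp at h0

/-- The ball has volume `β R³`, so this is a Gamma integral of `R⁴ exp (-λ β R³)`. -/
lemma radialFactor_lt_top {lam : ℝ≥0} (hlam : 0 < lam) : radialFactor lam ≠ ∞ := by
  set β : ℝ := (volume (Metric.ball (0 : E3) 1)).toReal with hβ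
  have hβ0 : 0 < β := ENNReal.toReal_pos (Metric.measure_ball_pos _ _ one_pos).ne'
    measure_ball_lt_top.ne
  have hb : 0 < lam * β := by positivity
  have hint := (integrableOn_rpow_mul_exp_neg_mul_rpow (p := 3) (s := 4) (b := lam * β)
    (by norm_num) (by norm_num) hb).const_mul (16 / 3)
  refine ne_of_lt (lt_of_eq_of_lt ?_ hint.lintegral_lt_top)
  refine setLIntegral_congr_fun measurableSet_Ioi fun R hR => ?_
  have hR' : (0 : ℝ) ≤ R := le_of_lt hR
  rw [ballVoidProb, voidProb, ← ENNReal.ofReal_mul (by positivity)]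
  congr 1
  rw [Measure.addHaar_ball _ _ hR', ENNReal.toReal_mul, ENNReal.toReal_ofReal (by positivity)]
  have e3 : R ^ (3 : ℝ) = R ^ (3 : ℕ) := by exact_mod_cast Real.rpow_natCast R 3
  have e4 : R ^ (4 : ℝ) = R ^ (4 : ℕ) := by exact_mod_cast Real.rpow_natCast R 4
  rw [e3, e4, finrank_euclideanSpace_fin, ← hβ]
  rw [mul_assoc (16 / 3 : ℝ)]
  congr 3
  ring

end Density

/-! ### The constant and the Palm distribution -/

section Palm

lemma measurable_abs_inner_div_norm (d : E3) :
    Measurable fun v : E3 => ENNReal.ofReal (|inner ℝ v d| / ‖v‖) := by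
  have h : Measurable fun v : E3 => (inner ℝ v d : ℝ) := by fun_prop
  exact (h.abs.div measurable_norm).ennreal_ofReal

/-- The integral of the cosine of the angle with `d` over the unit sphere. -/
def directionFactor (d : E3) : ℝ≥0∞ :=
  ∫⁻ u : Metric.sphere (0 : E3) 1, ENNReal.ofReal (|inner ℝ (u : E3) d| / ‖(u : E3)‖)
    ∂(volume : Measure E3).toSphere

lemma lintegral_direction (d : E3) {J : ℝ → ℝ≥0∞} (hJ : Measurable J) :
    ∫⁻ v : E3, ENNReal.ofReal (|inner ℝ v d| / ‖v‖) * J ‖v‖ =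
      directionFactor d * ∫⁻ ρ in Ioi (0 : ℝ), ENNReal.ofReal (ρ ^ 2) * J ρ := by
  refine lintegral_direction_mul_radial (κ := fun v => ENNReal.ofReal (|inner ℝ v d| / ‖v‖))
    (measurable_abs_inner_div_norm d) (fun c v hc => ?_) hJ
  rw [inner_smul_left, norm_smul, abs_mul, Real.norm_eq_abs, conj_trivial,
    mul_div_mul_left _ _ (abs_pos.2 hc.ne').ne']

lemma directionFactor_lt_top {d : E3} (hd : ‖d‖ = 1) : directionFactor d ≠ ∞ := by
  refine ne_of_lt (lt_of_le_of_lt (lintegral_mono (g := fun _ => 1) fun u => ?_) ?_)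
  · rw [ENNReal.ofReal_le_one]
    have h1 := abs_real_inner_le_norm (u : E3) d
    rw [hd, mul_one] at h1
    exact div_le_one_of_le₀ h1 (norm_nonneg _)
  · rw [lintegral_one]
    exact measure_lt_top _ _

/-- If it vanished, polar coordinates with `J = 1` would give integral zero to a function that is
positive almost everywhere on the space. -/
lemma directionFactor_pos {d : E3} (hd : d ≠ 0) : directionFactor d ≠ 0 := by
  intro h0
  have h := lintegral_direction d (J := fun _ => 1) measurable_const
  simp only [mul_one] at h
  rw [h0, zero_mul, lintegral_eq_zero_iff (measurable_abs_inner_div_norm d)] at h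
  have h1 : ∀ᵐ v : E3, v ∉ {v : E3 | inner ℝ v d = 0} :=
    measure_eq_zero_iff_ae_notMem.1 (volume_inner_eq_zero hd)
  have h2 : ∀ᵐ _ : E3, False := by
    filter_upwards [h, h1] with v hv hv1
    simp only [Pi.zero_apply, ENNReal.ofReal_eq_zero] at hv
    have hv0 : v ≠ 0 := fun e => hv1 (by simp [e])
    have : 0 < |inner ℝ v d| / ‖v‖ := div_pos (abs_pos.2 hv1) (norm_pos_iff.2 hv0)
    linarith
  exact h2.exists.elim fun _ h => h

/-- The product form in `B` and `A` contains everything about the Palm distribution. The value of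
`K` is irrelevant, as it cancels in `palmProb`; only `0 < K < ∞` matters. -/
lemma IsPoissonProcess.exists_meanCrossings_eq {Ω : Type*} [MeasurableSpace Ω] {P : Measure Ω}
    [IsProbabilityMeasure P] {lam : ℝ≥0} (hlam : 0 < lam) {Φ : Ω → Set E3}
    (hΦ : IsPoissonProcess P Φ lam) {r : E3 → E3 → Prop} (hr : IsPairOrder r) {H : Set E3}
    (hH : IsPlaneOrientation H) (p : E3) {d : E3} (hd : ‖d‖ = 1) :
    ∃ K : ℝ≥0∞, K ≠ 0 ∧ K ≠ ∞ ∧ ∀ B A : Set ℝ, MeasurableSet B → MeasurableSet A →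
      meanCrossings P Φ r H p d B A =
        K * volume B * ∫⁻ t in A ∩ Ioo 0 (2 * Real.pi), angleDensity t := by
  have hd0 : d ≠ 0 := fun h => by simp [h] at hd
  have hπ : ENNReal.ofReal (2 * Real.pi) ≠ 0 :=
    (ENNReal.ofReal_pos.2 (by positivity)).ne'
  have hlam0 : (lam : ℝ≥0∞) ≠ 0 := by exact_mod_cast hlam.ne'
  refine ⟨lam ^ 2 * 4⁻¹ * (directionFactor d * (ENNReal.ofReal (2 * Real.pi) * radialFactor lam)),
    ?_, ?_, ?_⟩
  · refine mul_ne_zero (mul_ne_zero (pow_ne_zero _ hlam0) (by simp)) (mul_ne_zero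
      (directionFactor_pos hd0) (mul_ne_zero hπ (radialFactor_pos lam)))
  · refine ENNReal.mul_ne_top (ENNReal.mul_ne_top (by finiteness) (by simp)) (ENNReal.mul_ne_top
      (directionFactor_lt_top hd) (ENNReal.mul_ne_top ENNReal.ofReal_ne_top
        (radialFactor_lt_top hlam)))
  · intro B A hB hA
    have h := lintegral_anglePairs lam hr hH p d hB hA
    rw [lintegral_direction d (measurable_sliceIntegral lam hA), lintegral_sliceIntegral lam hA] at h
    rw [hΦ.meanCrossings_eq hr hH p hd0 hB hA]
    have h4 : (4 : ℝ≥0∞)⁻¹ * 4 = 1 := ENNReal.inv_mul_cancel (by simp) (by simp)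
    calc _ = lam ^ 2 * 4⁻¹ * (4 * ∫⁻ q in anglePairs r H p d B A,
          voidProb lam (Metric.ball (bisectorPoint p d q) (bisectorRadius p d q))) := by
          rw [mul_assoc (lam ^ 2 : ℝ≥0∞), ← mul_assoc (4⁻¹ : ℝ≥0∞), h4, one_mul]
      _ = _ := by rw [h]; ring

end Palm

end

end PoissonVoronoi

theorem mainTheorem3 {Ω : Type*} [MeasurableSpace Ω] (P : Measure Ω) [IsProbabilityMeasure P]
    (lam : ℝ≥0) (hlam : 0 < lam)
    (Φ : Ω → Set PoissonVoronoi.E3) (hΦ : PoissonVoronoi.IsPoissonProcess P Φ lam)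
    (r : PoissonVoronoi.E3 → PoissonVoronoi.E3 → Prop) (hr : PoissonVoronoi.IsPairOrder r)
    (H : Set PoissonVoronoi.E3) (hH : PoissonVoronoi.IsPlaneOrientation H)
    (p d : PoissonVoronoi.E3) (hd : ‖d‖ = 1) :
    -- almost surely, every crossing lies on exactly one two-dimensional facet, created by
    -- exactly one ordered pair of nuclei, so that its angle is well defined
    (∀ᵐ ω ∂P, ∀ z ∈ PoissonVoronoi.crossings (Φ ω) p d, ∃! q : PoissonVoronoi.E3 × PoissonVoronoi.E3,
      r q.1 q.2 ∧ PoissonVoronoi.OnTwoFacet (Φ ω) q.1 q.2 (PoissonVoronoi.linePoint p d z)) ∧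
    -- the Palm distribution is well defined: the intensity is positive and finite, and
    -- Palm probabilities do not depend on the window
    0 < PoissonVoronoi.crossingIntensity P Φ p d ∧
    PoissonVoronoi.crossingIntensity P Φ p d < ∞ ∧
    (∀ B A : Set ℝ, MeasurableSet B → MeasurableSet A →
      PoissonVoronoi.meanCrossings P Φ r H p d B A =
        PoissonVoronoi.crossingIntensity P Φ p d * volume B *
          PoissonVoronoi.palmProb P Φ r H p d A) ∧
    -- the density of the Palm distribution
    (∀ A : Set ℝ, MeasurableSet A →
      PoissonVoronoi.palmProb P Φ r H p d A =
        ∫⁻ t in A ∩ Ioo 0 (2 * Real.pi),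
          ENNReal.ofReal (3 / 4 * |Real.cos (t / 2)| * Real.sin (t / 2) ^ 2)) ∧
    -- the equivalent formula for the tail
    (∀ t ∈ Ioo 0 Real.pi,
      PoissonVoronoi.palmProb P Φ r H p d (Ioo t Real.pi) =
        ENNReal.ofReal (1 / 2 * (1 - Real.sin (t / 2) ^ 3))) := by
  have hd0 : d ≠ 0 := fun h => by simp [h] at hd
  obtain ⟨K, hK0, hKtop, hK⟩ := hΦ.exists_meanCrossings_eq hlam hr hH p hd
  -- The density has total mass `1`, so the unit window and all angles give exactly `K`.
  have hμ : PoissonVoronoi.crossingIntensity P Φ p d = K := by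
    rw [PoissonVoronoi.crossingIntensity_eq P Φ r H p d, hK _ _ measurableSet_Icc .univ, univ_inter,
      PoissonVoronoi.lintegral_angleDensity]
    simp
  have hpalm : ∀ A : Set ℝ, MeasurableSet A → PoissonVoronoi.palmProb P Φ r H p d A =
      ∫⁻ t in A ∩ Ioo 0 (2 * Real.pi), PoissonVoronoi.angleDensity t := by
    intro A hA
    rw [PoissonVoronoi.palmProb, hμ, hK _ _ measurableSet_Icc hA]
    simp only [Real.volume_Icc, sub_zero, ENNReal.ofReal_one, mul_one]
    rw [mul_comm, mul_div_assoc, ENNReal.div_self hK0 hKtop, mul_one]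
  refine ⟨hΦ.ae_existsUnique_pair hr p hd0, ?_, ?_, ?_, hpalm, ?_⟩
  · rw [hμ]
    exact pos_iff_ne_zero.2 hK0
  · rw [hμ]
    exact hKtop.lt_top
  · intro B A hB hA
    rw [hpalm A hA, hμ, hK B A hB hA]
  · intro t ht
    have hsub : Ioo t Real.pi ∩ Ioo 0 (2 * Real.pi) = Ioo t Real.pi :=
      inter_eq_left.2 fun s hs => ⟨ht.1.trans hs.1, by linarith [hs.2, Real.pi_pos]⟩
    rw [hpalm _ measurableSet_Ioo, hsub,
      PoissonVoronoi.lintegral_angleDensity_Ioo ht.1.le ht.2.le le_rfl, Real.sin_pi_div_two,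
      one_pow]
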